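/- Let $f:\mathbb{R}^n\to\mathbb{R}\cup\{+\infty\}$ be proper, convex and lower semicontinuous, and let $g:\mathbb{R}^n\to\mathbb{R}$ be Fréchet differentiable with $\|\nabla g(x)-\nabla g(y)\|\le\beta\|x-y\|$ for all $x,y\in\mathbb{R}^n$, where $\beta\ge 0$. Assume that $f+g$ is bounded from below. Let $\gamma,\lambda>0$ and put $L=\min(L_1,L_2)$, where $$L_1=\sqrt{\max\big((\gamma+1)^2,(\gamma+2)((1+\lambda\beta)^2+1)\big)},\qquad L_2=\sqrt{\max\big((\gamma+1)^2+\gamma\lambda\beta,(2+\lambda\beta)^2+\gamma(2+\lambda\beta)\big)},$$ and assume that $$A=-\frac{\gamma}{2\lambda}+\frac{\beta}{2}(L^2+2\gamma^2+1)<0,\qquad B=-\frac{\gamma}{2L^2\lambda}+\frac{\beta}{2}(L^2+\gamma^2+1)<0,\qquad C=-\frac{2L^2+1}{(L^2+1)^2}\gamma^2+3\beta\gamma\lambda-1<0.$$ For $u_0,v_0\in\mathbb{R}^n$ let $x\in C^2([0,+\infty),\mathbb{R}^n)$ be the unique global solution of $$\ddot x(t)+\gamma\dot x(t)+x(t)=\operatorname{prox}_{\lambda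 f}\big(x(t)-\lambda\nabla g(x(t))\big)\quad(t\ge 0),\qquad x(0)=u_0,\ \dot x(0)=v_0,$$ where $\operatorname{prox}_{\lambda f}(z)=\operatorname{argmin}_{y\in\mathbb{R}^n}\{f(y)+\frac{1}{2\lambda}\|y-z\|^2\}$. For $h:\mathbb{R}^m\to\mathbb{R}\cup\{+\infty\}$ and $u$ with $h(u)<+\infty$, let $\hat\partial h(u)$ be the set of all $v$ with $\liminf_{y\to u}\frac{h(y)-h(u)-\langle v,y-u\rangle}{\|y-u\|}\ge 0$, and let the limiting subdifferential $\partial h(u)$ be the set of all $v$ for which there are $u_k\to u$ with $h(u_k)\to h(u)$ and $v_k\in\hat\partial h(u_k)$ with $v_k\to v$; if $h(u)=+\infty$, both sets are empty. Write $\operatorname{crit}(h)=\{u:0\in\partial h(u)\}$. The function $h$ is called a KL function if for every $\bar u$ with $\partial h(\bar u)\ne\emptyset$ there are $\eta\in(0,+\infty]$, a neighborhood $U$ of $\bar u$ and a concave continuous $\varphi:[0,\eta)\to[0,+\infty)$ with $\varphi(0)=0$, continuously differentiable on $(0,\eta)$ with $\varphi'>0$ there, such that $\varphi'(h(u)-h(\bar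 u))\operatorname{dist}(0,\partial h(u))\ge 1$ for all $u\in U$ with $h(\bar u)<h(u)<h(\bar u)+\eta$ (with $\operatorname{dist}(0,\emptyset)=+\infty$). Suppose that $x$ is bounded and that $$H:\mathbb{R}^n\times\mathbb{R}^n\times\mathbb{R}^n\to\mathbb{R}\cup\{+\infty\},\quad H(u,v,w)=(f+g)(u)+\frac{1}{2\lambda}\|u-v\|^2-\frac{C}{2\lambda}\|w\|^2$$ is a KL function. Then (a) $\dot x\in L^1([0,+\infty),\mathbb{R}^n)$; (b) $\ddot x\in L^1([0,+\infty),\mathbb{R}^n)$; (c) there exists $\bar x\in\operatorname{crit}(f+g)$ such that $\lim_{t\to+\infty}x(t)=\bar x$. -/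

import Mathlib

open Set Filter Topology MeasureTheory

noncomputable section

namespace ProxGrad

section General

variable {E : Type*} [NormedAddCommGroup E] [InnerProductSpace ℝ E]

/-- `f : E → ℝ ∪ {+∞}` (it never takes the value `-∞`) is proper, convex and
lower semicontinuous. In `EReal` one has `0 * ⊤ = 0`. -/
structure IsProperConvexLSC (f : E → EReal) : Prop where
  ne_bot : ∀ x, f x ≠ ⊥
  proper : ∃ x, f x ≠ ⊤
  convex : ∀ (x y : E) (a b : ℝ), 0 ≤ a → 0 ≤ b → a + b = 1 →
    f (a • x + b • y) ≤ (a : EReal) * f x + (b : EReal) * f y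
  lsc : LowerSemicontinuous f

/-- `p` minimizes `y ↦ f y + ‖y - z‖² / (2 lam)` over the whole space. -/
def IsProxPoint (lam : ℝ) (f : E → EReal) (z p : E) : Prop :=
  ∀ y, f p + ((1 / (2 * lam) * ‖p - z‖ ^ 2 : ℝ) : EReal)
    ≤ f y + ((1 / (2 * lam) * ‖y - z‖ ^ 2 : ℝ) : EReal)

/-- The proximal point operator of `lam • f`: the minimizer of
`y ↦ f y + ‖y - z‖² / (2 lam)`. -/
def prox (lam : ℝ) (f : E → EReal) (z : E) : E :=
  Classical.epsilon (IsProxPoint lam f z)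

/-- The Fréchet (viscosity) subdifferential. -/
def frechetSubdiff (f : E → EReal) (x : E) : Set E :=
  {v | f x ≠ ⊤ ∧
    0 ≤ liminf (fun y => (f y - f x - ((inner ℝ v (y - x) : ℝ) : EReal)) / ((‖y - x‖ : ℝ) : EReal))
      (𝓝[≠] x)}

/-- The limiting (Mordukhovich) subdifferential. -/
def limitingSubdiff (f : E → EReal) (x : E) : Set E :=
  {v | f x ≠ ⊤ ∧ ∃ (xs vs : ℕ → E), Tendsto xs atTop (𝓝 x) ∧
    Tendsto (fun k => f (xs k)) atTop (𝓝 (f x)) ∧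
    (∀ k, vs k ∈ frechetSubdiff f (xs k)) ∧ Tendsto vs atTop (𝓝 v)}

/-- The set of (limiting-)critical points. -/
def crit (f : E → EReal) : Set E := {x | 0 ∈ limitingSubdiff f x}

/-- The class of desingularizing functions on `[0, η)`, for `η ∈ (0, +∞]`. -/
structure IsDesingularizing (η : EReal) (φ : ℝ → ℝ) : Prop where
  concave : ConcaveOn ℝ {s : ℝ | 0 ≤ s ∧ (s : EReal) < η} φ
  continuousOn : ContinuousOn φ {s : ℝ | 0 ≤ s ∧ (s : EReal) < η}
  nonneg : ∀ s : ℝ, 0 ≤ s → (s : EReal) < η → 0 ≤ φ s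
  zero : φ 0 = 0
  contDiffOn : ContDiffOn ℝ 1 φ {s : ℝ | 0 < s ∧ (s : EReal) < η}
  deriv_pos : ∀ s : ℝ, 0 < s → (s : EReal) < η → 0 < deriv φ s

/-- The Kurdyka–Łojasiewicz property of `f` at `xbar`. The distance to the empty set is `+∞`. -/
def KLAt (f : E → EReal) (xbar : E) : Prop :=
  ∃ η : EReal, 0 < η ∧ ∃ U ∈ 𝓝 xbar, ∃ φ : ℝ → ℝ, IsDesingularizing η φ ∧
    ∀ x ∈ U, f xbar < f x → f x < f xbar + η →
      1 ≤ ENNReal.ofReal (deriv φ ((f x).toReal - (f xbar).toReal)) *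
        Metric.infEDist 0 (limitingSubdiff f x)

/-- `f` is a KL function: it has the KL property at each point of the domain of its
limiting subdifferential. -/
def IsKL (f : E → EReal) : Prop := ∀ xbar, (limitingSubdiff f xbar).Nonempty → KLAt f xbar

/-- The sum of an extended-real-valued and a real-valued function. -/
def addFun (f : E → EReal) (g : E → ℝ) (u : E) : EReal := f u + (g u : EReal)

/-- The function `H(u,v,w) = (f+g)(u) + ‖u - v‖² / (2 lam) - C ‖w‖² / (2 lam)` on the
Euclidean product `E × E × E`, a point being `(z 0, z 1, z 2) = (u, v, w)`. -/
def regularization (lam C : ℝ) (f : E → EReal) (g : E → ℝ)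
    (z : PiLp 2 (fun _ : Fin 3 => E)) : EReal :=
  addFun f g (z 0) +
    ((1 / (2 * lam) * ‖z 0 - z 1‖ ^ 2 - C / (2 * lam) * ‖z 2‖ ^ 2 : ℝ) : EReal)

/-- The first derivative on `[0, ∞)` (one-sided at `0`). -/
def vel (x : ℝ → E) : ℝ → E := derivWithin x (Ici 0)

/-- The second derivative on `[0, ∞)` (one-sided at `0`). -/
def acc (x : ℝ → E) : ℝ → E := derivWithin (vel x) (Ici 0)

/-- `x ∈ C²([0, ∞))` solves `x'' + γ x' + x = prox_{lam f} (x - lam ∇g(x))` on `[0, ∞)`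
with `x(0) = u₀` and `x'(0) = v₀`. -/
structure IsTrajectory [CompleteSpace E] (γ lam : ℝ) (f : E → EReal) (g : E → ℝ) (u₀ v₀ : E)
    (x : ℝ → E) : Prop where
  contDiffOn : ContDiffOn ℝ 2 x (Ici 0)
  ode : ∀ t, 0 ≤ t → acc x t + γ • vel x t + x t = prox lam f (x t - lam • gradient g (x t))
  init_pos : x 0 = u₀
  init_vel : vel x 0 = v₀

end General

def L₁ (β γ lam : ℝ) : ℝ :=
  Real.sqrt (max ((γ + 1) ^ 2) ((γ + 2) * ((1 + lam * β) ^ 2 + 1)))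

def L₂ (β γ lam : ℝ) : ℝ :=
  Real.sqrt (max ((γ + 1) ^ 2 + γ * lam * β) ((2 + lam * β) ^ 2 + γ * (2 + lam * β)))

def L (β γ lam : ℝ) : ℝ := min (L₁ β γ lam) (L₂ β γ lam)

def constA (β γ lam : ℝ) : ℝ :=
  -(1 / 2) * (γ / lam) + β / 2 * (L β γ lam ^ 2 + 2 * γ ^ 2 + 1)

def constB (β γ lam : ℝ) : ℝ :=
  -(1 / (2 * L β γ lam ^ 2)) * (γ / lam) + β / 2 * (L β γ lam ^ 2 + γ ^ 2 + 1)

def constC (β γ lam : ℝ) : ℝ :=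
  -((2 * L β γ lam ^ 2 + 1) / (L β γ lam ^ 2 + 1) ^ 2) * γ ^ 2 + 3 * β * γ * lam - 1

/-- The parameter conditions. -/
def CondRho (β γ lam : ℝ) : Prop :=
  constA β γ lam < 0 ∧ constB β γ lam < 0 ∧ constC β γ lam < 0

end ProxGrad

end

/-! Write `v = x'`, `a = x''`, `y = a + γ v + x` and `δ = 1 / (L² + 1)`. The equation says that `y`
is a proximal point, so `-(a + γ v) / lam - ∇g(x)` is a subgradient of `f` at `y`, and `y` varies at
most `1 + lam β` times as fast as `x`. The energy is the function `H` evaluated along `(y, x + δ γ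
v, v)`.

Neither `a` nor `y` need be differentiable, and `f` is nonsmooth. The energy is therefore
differentiated only through its upper right Dini derivative: convexity bounds increments of `f(y)`
from above by the subgradient, and the increment of `y` enters only through its norm. The outcome
(`dissipation_le`, `IsProxFlow.energy_dini`) is that the energy decreases at rate at least `-(A ‖v‖²
+ B ‖a‖²)`. Being bounded below, it converges. As `‖v‖² + ‖a‖²` grows at most exponentially, its
value at `t` is controlled by its integral over `[t - 1, t]`, hence by an energy drop, so `v` and
`a` tend to `0`.

At a limit point `xbar` of the bounded curve, closedness of the subdifferential graph gives
criticality and identifies the value of `H` at `(xbar, xbar, 0)` with the limit `e` of the energy.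
Along the curve `H` has a subgradient of norm `O(‖v‖ + ‖a‖)`. The KL inequality then makes `φ(energy
- e)` decrease at a rate proportional to `‖v‖ + ‖a‖` while `x` stays near `xbar`; a first-exit
argument keeps it there (`IsProxFlow.exists_length_bound`). So `v` and `a` are integrable and `x`
converges. -/

noncomputable section

namespace ProxGrad

open Asymptotics

/-! ### Proximal points and subgradients -/

section ConvexAnalysis

variable {E : Type*} [NormedAddCommGroup E] [InnerProductSpace ℝ E]

/-- `w` is a subgradient of `f` at `p` in the sense of convex analysis. -/
def IsSubgradient (f : E → EReal) (p w : E) : Prop :=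
  f p ≠ ⊤ ∧ ∀ u, f p + ((inner ℝ w (u - p) : ℝ) : EReal) ≤ f u

/-- A quadratic minorant of curvature below that of the proximal term makes the objective coercive.
Lower semicontinuity then gives a minimizer on a large closed ball, which beats every point outside
it. -/
theorem exists_isProxPoint [ProperSpace E] {f : E → EReal} (hf : IsProperConvexLSC f)
    {lam : ℝ} {z : E} {m K k : ℝ} (hk : k < 1 / (2 * lam))
    (hlow : ∀ y, ((m - K * ‖y - z‖ - k * ‖y - z‖ ^ 2 : ℝ) : EReal) ≤ f y) :
    ∃ p, IsProxPoint lam f z p := by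
  obtain ⟨y₀, hy₀⟩ := hf.proper
  lift f y₀ to ℝ using ⟨hy₀, hf.ne_bot y₀⟩ with c hc
  set c₀ := c + 1 / (2 * lam) * ‖y₀ - z‖ ^ 2 with hc₀
  have hd : 0 < 1 / (2 * lam) - k := sub_pos.2 hk
  have ht : Tendsto (fun r : ℝ => m + r * ((1 / (2 * lam) - k) * r - K)) atTop atTop := by
    refine tendsto_atTop_add_const_left _ _ (tendsto_id.atTop_mul_atTop₀ ?_)
    exact tendsto_atTop_add_const_right _ (-K) (tendsto_id.const_mul_atTop hd)
  obtain ⟨R, hR⟩ := eventually_atTop.1 (ht.eventually_ge_atTop c₀)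
  have hlsc : LowerSemicontinuous
      (fun y => f y + ((1 / (2 * lam) * ‖y - z‖ ^ 2 : ℝ) : EReal)) := by
    refine hf.lsc.add' (Continuous.lowerSemicontinuous ?_) ?_
    · exact continuous_coe_real_ereal.comp (by fun_prop)
    · intro x
      exact EReal.continuousAt_add (Or.inr (EReal.coe_ne_bot _)) (Or.inr (EReal.coe_ne_top _))
  obtain ⟨p, hp, hmin⟩ := (hlsc.lowerSemicontinuousOn _).exists_isMinOn
    (s := Metric.closedBall z (max R ‖y₀ - z‖))
    ⟨z, Metric.mem_closedBall_self ((norm_nonneg _).trans (le_max_right _ _))⟩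
    (isCompact_closedBall _ _)
  refine ⟨p, fun y => ?_⟩
  by_cases hy : y ∈ Metric.closedBall z (max R ‖y₀ - z‖)
  · exact hmin hy
  · have hy' : R ≤ ‖y - z‖ := by
      rw [Metric.mem_closedBall, dist_eq_norm, not_le] at hy
      exact (le_max_left _ _).trans hy.le
    have h1 := isMinOn_iff.1 hmin y₀ (by
      rw [Metric.mem_closedBall, dist_eq_norm]; exact le_max_right _ _)
    rw [← hc, ← EReal.coe_add, ← hc₀] at h1
    refine h1.trans ?_
    refine le_trans ?_ (add_le_add_left (hlow y) _)
    rw [← EReal.coe_add, EReal.coe_le_coe_iff]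
    have := hR _ hy'
    nlinarith

/-- Compare `p` with `t u + (1 - t) p`, divide by `t` and let `t → 0`: the quadratic error
disappears. -/
theorem IsProxPoint.isSubgradient {f : E → EReal} (hf : IsProperConvexLSC f) {lam : ℝ}
    (hlam : 0 < lam) {z p : E} (hp : IsProxPoint lam f z p) :
    IsSubgradient f p ((1 / lam) • (z - p)) := by
  have hfp : f p ≠ ⊤ := by
    obtain ⟨y₀, hy₀⟩ := hf.proper
    intro h
    have h1 := hp y₀
    lift f y₀ to ℝ using ⟨hy₀, hf.ne_bot y₀⟩ with c
    rw [h, EReal.top_add_coe, ← EReal.coe_add, top_le_iff] at h1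
    exact EReal.coe_ne_top _ h1
  refine ⟨hfp, fun u => ?_⟩
  by_cases hu : f u = ⊤
  · rw [hu]; exact le_top
  have hc := fun t ht0 ht1 => hf.convex u p t (1 - t) ht0 ht1 (by ring)
  lift f u to ℝ using ⟨hu, hf.ne_bot u⟩ with fu hfu
  have hp' := hp
  unfold IsProxPoint at hp'
  lift f p to ℝ using ⟨hfp, hf.ne_bot p⟩ with fp hfp'
  rw [← EReal.coe_add, EReal.coe_le_coe_iff, real_inner_smul_left]
  have key : ∀ t ∈ Ioo (0 : ℝ) 1,
      fp + 1 / lam * inner ℝ (z - p) (u - p) ≤ fu + t * (1 / (2 * lam) * ‖u - p‖ ^ 2) := by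
    intro t ht
    have h1 := hc t ht.1.le (by linarith [ht.2])
    have h2 := (hp' (t • u + (1 - t) • p)).trans (add_le_add_left h1 _)
    norm_cast at h2
    have e : t • u + (1 - t) • p - z = (p - z) + t • (u - p) := by module
    rw [e, norm_add_sq_real, real_inner_smul_right, norm_smul, Real.norm_eq_abs,
      abs_of_pos ht.1, ← neg_sub z p, inner_neg_left, norm_neg] at h2
    have h3 : t * (fp + 1 / lam * inner ℝ (z - p) (u - p)) ≤
        t * (fu + t * (1 / (2 * lam) * ‖u - p‖ ^ 2)) := by
      have : 1 / lam = 2 * (1 / (2 * lam)) := by field_simp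
      rw [this]
      nlinarith
    exact le_of_mul_le_mul_left h3 ht.1
  have hlim : Tendsto (fun t : ℝ => fu + t * (1 / (2 * lam) * ‖u - p‖ ^ 2)) (𝓝[>] 0) (𝓝 fu) := by
    have : Continuous (fun t : ℝ => fu + t * (1 / (2 * lam) * ‖u - p‖ ^ 2)) := by fun_prop
    simpa using (this.tendsto 0).mono_left nhdsWithin_le_nhds
  exact ge_of_tendsto hlim (eventually_of_mem (Ioo_mem_nhdsGT one_pos) key)

theorem IsSubgradient.inner_sub_nonneg {f : E → EReal} (hb : ∀ x, f x ≠ ⊥) {p q v w : E}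
    (hp : IsSubgradient f p v) (hq : IsSubgradient f q w) : 0 ≤ inner ℝ (v - w) (p - q) := by
  have h1 := hp.2 q
  have h2 := hq.2 p
  lift f p to ℝ using ⟨hp.1, hb p⟩ with fp
  lift f q to ℝ using ⟨hq.1, hb q⟩ with fq
  norm_cast at h1 h2
  rw [inner_sub_left]
  rw [← neg_sub p q, inner_neg_right] at h1
  linarith

/-- Monotonicity of the subdifferential gives `‖p₁ - p₂‖² ≤ ⟪z₁ - z₂, p₁ - p₂⟫`; Cauchy–Schwarz
finishes. -/
theorem IsProxPoint.norm_sub_le {f : E → EReal} (hf : IsProperConvexLSC f) {lam : ℝ}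
    (hlam : 0 < lam) {z₁ z₂ p₁ p₂ : E} (h₁ : IsProxPoint lam f z₁ p₁)
    (h₂ : IsProxPoint lam f z₂ p₂) : ‖p₁ - p₂‖ ≤ ‖z₁ - z₂‖ := by
  have h := (h₁.isSubgradient hf hlam).inner_sub_nonneg hf.ne_bot (h₂.isSubgradient hf hlam)
  rw [← smul_sub, real_inner_smul_left] at h
  have h' : 0 ≤ inner ℝ (z₁ - p₁ - (z₂ - p₂)) (p₁ - p₂) :=
    nonneg_of_mul_nonneg_right h (by positivity)
  rw [show z₁ - p₁ - (z₂ - p₂) = (z₁ - z₂) - (p₁ - p₂) by abel, inner_sub_left,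
    real_inner_self_eq_norm_sq] at h'
  have h2 := real_inner_le_norm (z₁ - z₂) (p₁ - p₂)
  by_contra! hlt
  have : 0 < ‖p₁ - p₂‖ := (norm_nonneg _).trans_lt hlt
  nlinarith

/-- Trades the extended-real difference quotient for an additive lower estimate with an arbitrarily
small linear error. -/
theorem mem_frechetSubdiff_of_eventually {h : E → EReal} {z ξ : E} {r : ℝ} (hz : h z = r)
    (H : ∀ ε > 0, ∀ᶠ y in 𝓝 z,
      ((r + inner ℝ ξ (y - z) - ε * ‖y - z‖ : ℝ) : EReal) ≤ h y) :
    ξ ∈ frechetSubdiff h z := by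
  refine ⟨by rw [hz]; exact EReal.coe_ne_top _, ?_⟩
  refine le_of_forall_lt fun c hc => ?_
  obtain ⟨d, hcd, hd⟩ := EReal.lt_iff_exists_real_btwn.1 hc
  refine hcd.trans_le (le_liminf_of_le (by isBoundedDefault) ?_)
  have hd' : 0 < -d := by
    have : d < 0 := by exact_mod_cast hd
    linarith
  filter_upwards [(H _ hd').filter_mono nhdsWithin_le_nhds, self_mem_nhdsWithin] with y hy hne
  have hpos : 0 < ‖y - z‖ := norm_pos_iff.2 (sub_ne_zero.2 hne)
  rw [EReal.le_div_iff_mul_le (by exact_mod_cast hpos) (EReal.coe_ne_top _), hz]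
  induction hh : h y with
  | bot => rw [hh, le_bot_iff] at hy; exact absurd hy (EReal.coe_ne_bot _)
  | top => rw [EReal.top_sub_coe, EReal.top_sub_coe]; exact le_top
  | coe s =>
    rw [hh, EReal.coe_le_coe_iff] at hy
    norm_cast
    linarith

theorem frechetSubdiff_subset_limitingSubdiff (h : E → EReal) (z : E) :
    frechetSubdiff h z ⊆ limitingSubdiff h z := fun ξ hξ =>
  ⟨hξ.1, fun _ => z, fun _ => ξ, tendsto_const_nhds, tendsto_const_nhds, fun _ => hξ,
    tendsto_const_nhds⟩

theorem IsSubgradient.add_mem_limitingSubdiff {F : E → EReal} (hb : ∀ x, F x ≠ ⊥) {G : E → ℝ}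
    {G' : E →L[ℝ] ℝ} {z ω ξ : E} (hω : IsSubgradient F z ω) (hG : HasFDerivAt G G' z)
    (hξ : ∀ d, inner ℝ ξ d = inner ℝ ω d + G' d) : ξ ∈ limitingSubdiff (addFun F G) z := by
  apply frechetSubdiff_subset_limitingSubdiff
  obtain ⟨htop, hω⟩ := hω
  lift F z to ℝ using ⟨htop, hb z⟩ with fz hfz
  refine mem_frechetSubdiff_of_eventually (r := fz + G z) (by simp [addFun, ← hfz]) fun ε hε => ?_
  filter_upwards [hG.isLittleO.bound hε] with y hy
  have h1 := add_le_add_left (hω y) (G y : EReal)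
  refine le_trans ?_ h1
  norm_cast
  rw [hξ]
  have := neg_le_of_abs_le hy
  linarith

/-- The graph of the subdifferential of a lower semicontinuous function is closed along sequences
with convergent values, and the values converge to the value at the limit. -/
theorem IsSubgradient.of_tendsto {f : E → EReal} (hb : ∀ x, f x ≠ ⊥) (hl : LowerSemicontinuous f)
    {y w : ℕ → E} {F : ℕ → ℝ} {ybar wbar : E} {c : ℝ} (hs : ∀ k, IsSubgradient f (y k) (w k))
    (hF : ∀ k, f (y k) = F k) (hy : Tendsto y atTop (𝓝 ybar)) (hw : Tendsto w atTop (𝓝 wbar))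
    (hc : Tendsto F atTop (𝓝 c)) : f ybar = c ∧ IsSubgradient f ybar wbar := by
  have key : ∀ u, ((c + inner ℝ wbar (u - ybar) : ℝ) : EReal) ≤ f u := fun u => by
    by_cases hu : f u = ⊤
    · rw [hu]; exact le_top
    have hs' := fun k => (hs k).2 u
    lift f u to ℝ using ⟨hu, hb u⟩ with fu
    rw [EReal.coe_le_coe_iff]
    refine le_of_tendsto (hc.add (hw.inner (tendsto_const_nhds.sub hy))) (Eventually.of_forall ?_)
    intro k
    have := hs' k
    rw [hF k] at this
    exact_mod_cast this
  -- Lower semicontinuity along the sequence; the reverse inequality is `key` at `u = ybar`.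
  have hle : f ybar ≤ c := by
    refine le_of_forall_lt fun d hd => ?_
    by_contra! hcd
    obtain ⟨e, he1, he2⟩ := exists_between hd
    have h1 := hy.eventually (hl ybar e he2)
    have h2 : Tendsto (fun k => (F k : EReal)) atTop (𝓝 (c : EReal)) :=
      (continuous_coe_real_ereal.tendsto c).comp hc
    have h3 := h2.eventually (gt_mem_nhds (hcd.trans_lt he1))
    obtain ⟨k, hk1, hk2⟩ := (h1.and h3).exists
    rw [hF k] at hk1
    exact lt_asymm hk1 hk2
  have heq : f ybar = c := le_antisymm hle (by simpa using key ybar)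
  refine ⟨heq, by rw [heq]; exact EReal.coe_ne_top _, fun u => ?_⟩
  rw [heq]
  exact_mod_cast key u

end ConvexAnalysis

/-! ### Dini derivatives and integral estimates -/

section Calculus

/-- An upper bound on the upper right Dini derivative can be integrated. -/
theorem sub_le_integral_of_dini {F G : ℝ → ℝ} {a b : ℝ} (hab : a ≤ b)
    (hF : ContinuousOn F (Icc a b)) (hG : ContinuousOn G (Icc a b))
    (h : ∀ t ∈ Ico a b, ∀ ε > 0, ∀ᶠ s in 𝓝[>] t, F s - F t ≤ (G t + ε) * (s - t)) :
    F b - F a ≤ ∫ t in a..b, G t := by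
  have hint : IntervalIntegrable G volume a b := hG.intervalIntegrable_of_Icc hab
  have key := image_le_of_liminf_slope_right_le_deriv_boundary hF
    (B := fun u => F a + ∫ t in a..u, G t) (B' := G) (by simp) ?_ ?_ ?_ (right_mem_Icc.2 hab)
  · linarith
  · refine continuousOn_const.add ?_
    have := intervalIntegral.continuousOn_primitive_interval (μ := volume) (f := G) (a := a)
      (b := b) ?_
    · rwa [uIcc_of_le hab] at this
    · rw [uIcc_of_le hab]; exact hG.integrableOn_Icc
  · intro t ht
    refine HasDerivWithinAt.const_add _ ?_
    have hnhds : Icc a b ∈ 𝓝[>] t := mem_of_superset (Ioo_mem_nhdsGT ht.2) fun s hs =>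
      ⟨ht.1.trans hs.1.le, hs.2.le⟩
    refine intervalIntegral.integral_hasDerivWithinAt_right (t := Ioi t)
      (hint.mono_set ?_) ?_ ?_
    · rw [uIcc_of_le hab, uIcc_of_le ht.1]; exact Icc_subset_Icc_right ht.2.le
    · exact ⟨Icc a b, hnhds, hG.aestronglyMeasurable measurableSet_Icc⟩
    · exact ((hG t ⟨ht.1, ht.2.le⟩).mono_of_mem_nhdsWithin hnhds)
  · intro t ht r hr
    refine Eventually.frequently ?_
    -- Half the gap keeps the slope strictly below `r`.
    filter_upwards [h t ht ((r - G t) / 2) (by linarith), self_mem_nhdsWithin] with s hs hts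
    have hts' : 0 < s - t := sub_pos.2 hts
    rw [slope_def_field, div_lt_iff₀ hts']
    nlinarith

theorem concave_sub_le {φ : ℝ → ℝ} {S : Set ℝ} (hφ : ConcaveOn ℝ S φ) {p q : ℝ} (hp : p ∈ S)
    (hq : q ∈ S) (hd : DifferentiableAt ℝ φ p) : φ q - φ p ≤ deriv φ p * (q - p) := by
  rcases lt_trichotomy p q with h | h | h
  · have := hφ.slope_le_deriv hp hq h hd
    rwa [slope_def_field, div_le_iff₀ (sub_pos.2 h)] at this
  · simp [h]
  · have := hφ.deriv_le_slope hq hp h hd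
    rw [slope_def_field, le_div_iff₀ (sub_pos.2 h)] at this
    linarith

/-- A function controlled by its own integral over unit intervals is controlled pointwise. -/
theorem le_integral_of_sub_le_integral {h : ℝ → ℝ} {K t : ℝ} (hK : 0 ≤ K) (h0 : ∀ s, 0 ≤ h s)
    (hc : ContinuousOn h (Icc (t - 1) t))
    (H : ∀ s ∈ Icc (t - 1) t, h t - h s ≤ ∫ r in s..t, K * h r) :
    h t ≤ (1 + K) * ∫ r in (t - 1)..t, h r := by
  have hint : IntervalIntegrable h volume (t - 1) t := hc.intervalIntegrable_of_Icc (by linarith)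
  have h1 : ∀ s ∈ Icc (t - 1) t, h t - K * ∫ r in (t - 1)..t, h r ≤ h s := fun s hs => by
    have h2 := H s hs
    rw [intervalIntegral.integral_const_mul] at h2
    have h3 : ∫ r in s..t, h r ≤ ∫ r in (t - 1)..t, h r := by
      refine intervalIntegral.integral_mono_interval hs.1 hs.2 le_rfl ?_ hint
      exact Eventually.of_forall h0
    nlinarith
  have h4 := intervalIntegral.integral_mono_on (a := t - 1) (b := t) (by linarith)
    intervalIntegrable_const hint h1
  simp only [intervalIntegral.integral_const, sub_sub_cancel, one_smul] at h4
  linarith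

end Calculus

/-! ### Inequalities for the constant `L` -/

section Constants

variable {β γ lam : ℝ}

/-- Since `L` is a minimum, every estimate on it has to hold for each of the two candidates
separately. -/
theorem L_sq_cases (hβ : 0 ≤ β) (hγ : 0 < γ) (hlam : 0 < lam) :
    ((γ + 1) ^ 2 ≤ L β γ lam ^ 2 ∧ (γ + 2) * ((1 + lam * β) ^ 2 + 1) ≤ L β γ lam ^ 2) ∨
    ((γ + 1) ^ 2 + γ * lam * β ≤ L β γ lam ^ 2 ∧
      (2 + lam * β) ^ 2 + γ * (2 + lam * β) ≤ L β γ lam ^ 2) := by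
  rcases min_choice (L₁ β γ lam) (L₂ β γ lam) with h | h
  · left
    have : L β γ lam ^ 2 = max ((γ + 1) ^ 2) ((γ + 2) * ((1 + lam * β) ^ 2 + 1)) := by
      rw [L, h, L₁, Real.sq_sqrt ((sq_nonneg _).trans (le_max_left _ _))]
    rw [this]
    exact ⟨le_max_left _ _, le_max_right _ _⟩
  · right
    have : L β γ lam ^ 2 =
        max ((γ + 1) ^ 2 + γ * lam * β) ((2 + lam * β) ^ 2 + γ * (2 + lam * β)) := by
      rw [L, h, L₂, Real.sq_sqrt (le_trans (by positivity) (le_max_left _ _))]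
    rw [this]
    exact ⟨le_max_left _ _, le_max_right _ _⟩

/-- This is the property for which `L` is designed. The two candidates correspond to two ways of
splitting the cross term by Young's inequality: with weights `(2 + lam β)² / 2` and `2` for `L₁`,
with equal weights for `L₂`. -/
theorem norm_combination_sq_le {E : Type*} [NormedAddCommGroup E] [InnerProductSpace ℝ E]
    (hβ : 0 ≤ β) (hγ : 0 < γ) (hlam : 0 < lam) (v a : E) :
    ‖(2 + lam * β) • v + γ • a‖ ^ 2 ≤
      L β γ lam ^ 2 * ‖v‖ ^ 2 + (L β γ lam ^ 2 - 1) * ‖a‖ ^ 2 := by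
  have hm : 0 ≤ lam * β := by positivity
  rw [norm_add_sq_real, norm_smul, norm_smul, real_inner_smul_left, real_inner_smul_right,
    mul_pow, mul_pow, Real.norm_eq_abs, Real.norm_eq_abs, sq_abs, sq_abs]
  have hi := real_inner_le_norm v a
  have hv := sq_nonneg ‖v‖
  have ha := sq_nonneg ‖a‖
  set m := lam * β
  have h2 : 2 * inner ℝ v a ≤ ‖v‖ ^ 2 + ‖a‖ ^ 2 := by nlinarith [sq_nonneg (‖v‖ - ‖a‖)]
  rcases L_sq_cases hβ hγ hlam with ⟨h1, h3⟩ | ⟨h1, h3⟩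
  · have hvv := mul_le_mul_of_nonneg_right h3 hv
    have haa := mul_le_mul_of_nonneg_right h1 ha
    have hy : 2 * ((2 + m) * inner ℝ v a) ≤
        (2 + m) ^ 2 * ‖v‖ ^ 2 / 2 * 1 + 2 * ‖a‖ ^ 2 := by
      have : (2 + m) * inner ℝ v a ≤ (2 + m) * (‖v‖ * ‖a‖) :=
        mul_le_mul_of_nonneg_left hi (by linarith)
      nlinarith [sq_nonneg ((2 + m) * ‖v‖ - 2 * ‖a‖)]
    have h5 : (2 + m) ^ 2 ≤ 2 * ((1 + m) ^ 2 + 1) := by nlinarith [sq_nonneg m]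
    have h6 := mul_le_mul_of_nonneg_right h5 hv
    have h7 := mul_le_mul_of_nonneg_left hy hγ.le
    have h8 := mul_le_mul_of_nonneg_left h6 hγ.le
    nlinarith
  · have hvv := mul_le_mul_of_nonneg_right h3 hv
    have haa := mul_le_mul_of_nonneg_right h1 ha
    have h7 := mul_le_mul_of_nonneg_left h2 (mul_nonneg hγ.le (by linarith : 0 ≤ 2 + m))
    have e : γ * lam * β = γ * m := by ring
    rw [e] at haa
    nlinarith

theorem add_one_sq_le_L_sq (hβ : 0 ≤ β) (hγ : 0 < γ) (hlam : 0 < lam) :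
    (γ + 1) ^ 2 ≤ L β γ lam ^ 2 := by
  have : 0 ≤ γ * lam * β := by positivity
  rcases L_sq_cases hβ hγ hlam with h | h <;> linarith [h.1]

theorem two_le_L_sq (hβ : 0 ≤ β) (hγ : 0 < γ) (hlam : 0 < lam) :
    2 ≤ L β γ lam ^ 2 := by
  have hm : 0 ≤ lam * β := by positivity
  rcases L_sq_cases hβ hγ hlam with ⟨-, h⟩ | ⟨-, h⟩ <;> nlinarith [mul_nonneg hγ.le hm]

/-- Absorbs the `‖v‖²` terms left by the Young inequality with parameter `3` in `dissipation_le`. -/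
theorem sq_add_div_three_le_L_sq (hβ : 0 ≤ β) (hγ : 0 < γ) (hlam : 0 < lam) :
    γ ^ 2 + (1 + lam * β) ^ 2 / 3 ≤ L β γ lam ^ 2 + 1 := by
  have hm : 0 ≤ lam * β := by positivity
  set m := lam * β with hm_def
  rcases L_sq_cases hβ hγ hlam with ⟨h1, h2⟩ | ⟨h1, h2⟩
  · rcases le_total ((1 + m) ^ 2) (6 * γ + 6) with h | h
    · nlinarith
    · have : (γ + 2) * (6 * γ + 6) ≤ (γ + 2) * (1 + m) ^ 2 := by gcongr
      nlinarith [mul_nonneg hγ.le (sq_nonneg (1 + m))]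
  · have e : γ * lam * β = γ * m := by rw [hm_def]; ring
    rw [e] at h1
    rcases le_total (1 + m) (3 * γ) with h | h
    · nlinarith
    · nlinarith [mul_nonneg hγ.le hm]

end Constants

/-! ### The energy and its dissipation -/

section Energy

variable {E : Type*} [NormedAddCommGroup E] [InnerProductSpace ℝ E]
variable {β γ lam : ℝ} {f : E → EReal} {g : E → ℝ} {x : ℝ → E}

/-- The weight `1 / (L² + 1)`. -/
def weight (β γ lam : ℝ) : ℝ := 1 / (L β γ lam ^ 2 + 1)

theorem constC_eq (β γ lam : ℝ) : constC β γ lam =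
    -(1 - (1 - weight β γ lam) ^ 2) * γ ^ 2 + 3 * β * γ * lam - 1 := by
  have : L β γ lam ^ 2 + 1 ≠ 0 := by positivity
  rw [constC, weight]
  field_simp
  ring

/-- The value of `C` is chosen for the mixed terms `⟪v, a⟫`. Its summand `3 β γ lam` cancels the one
produced by Young's inequality on the `∇g` part; the others leave just `δ γ² / lam`, which pairs
with the square that bounds the proximal part. -/
theorem dissipation_le (hβ : 0 ≤ β) (hγ : 0 < γ) (hlam : 0 < lam) (v a : E) :
    (β * ‖a + γ • v‖ + γ * weight β γ lam / lam * ‖v‖) * ((1 + lam * β) * ‖v‖)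
      - 1 / lam * inner ℝ (a + ((1 - weight β γ lam) * γ) • v) (v + (weight β γ lam * γ) • a)
      - constC β γ lam / lam * inner ℝ v a
    ≤ constA β γ lam * ‖v‖ ^ 2 + constB β γ lam * ‖a‖ ^ 2 := by
  have hN := norm_combination_sq_le hβ hγ hlam v a
  have h1 := add_one_sq_le_L_sq hβ hγ hlam
  have h2 := two_le_L_sq hβ hγ hlam
  have h3 := sq_add_div_three_le_L_sq hβ hγ hlam
  have hC := constC_eq β γ lam
  set δ := weight β γ lam with hδ
  set l := 1 + lam * β with hl
  have hL : 0 < L β γ lam ^ 2 := by linarith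
  have hδ' : δ * (L β γ lam ^ 2 + 1) = 1 := by rw [hδ, weight]; field_simp
  have hδ0 : 0 < δ := by rw [hδ, weight]; positivity
  rw [constA, constB, hC]
  set M := L β γ lam ^ 2 with hM
  have e1 : inner ℝ (a + ((1 - δ) * γ) • v) (v + (δ * γ) • a) =
      (1 + (1 - δ) * δ * γ ^ 2) * inner ℝ v a + δ * γ * ‖a‖ ^ 2 + (1 - δ) * γ * ‖v‖ ^ 2 := by
    simp only [inner_add_left, inner_add_right, real_inner_smul_left, real_inner_smul_right,
      real_inner_self_eq_norm_sq, real_inner_comm v a]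
    ring
  rw [e1]
  -- the smooth part
  have hs : ‖a + γ • v‖ * (l * ‖v‖) - 3 * γ * inner ℝ v a ≤
      1 / 2 * ((M + 2 * γ ^ 2 + 1) * ‖v‖ ^ 2 + (M + γ ^ 2 + 1) * ‖a‖ ^ 2) := by
    have e2 : ‖a + γ • v‖ ^ 2 = ‖a‖ ^ 2 + 2 * γ * inner ℝ v a + γ ^ 2 * ‖v‖ ^ 2 := by
      rw [norm_add_sq_real, real_inner_smul_right, norm_smul, mul_pow, Real.norm_eq_abs, sq_abs,
        real_inner_comm v a]
      ring
    -- The weight `3` makes the mixed term of `(3 / 2) ‖a + γ v‖²` exactly `3 γ ⟪v, a⟫`.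
    have h4 := sq_nonneg (3 * ‖a + γ • v‖ - l * ‖v‖)
    have h5 := mul_le_mul_of_nonneg_right h3 (sq_nonneg ‖v‖)
    have h6 := mul_le_mul_of_nonneg_right h2 (sq_nonneg ‖a‖)
    have h7 := mul_nonneg (sq_nonneg γ) (sq_nonneg ‖a‖)
    nlinarith
  -- the proximal part
  have hp : M * (l * ‖v‖ ^ 2 + γ * inner ℝ v a - ‖a‖ ^ 2 - M * ‖v‖ ^ 2) ≤
      -(1 / 2) * (M + 1) * (M * ‖v‖ ^ 2 + ‖a‖ ^ 2) := by
    -- Expanding this square bounds `2 M ⟪v, (2 + lam β) v + γ a⟫`, and `hN` controls the squared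
    -- norm of the combination.
    have h4 := sq_nonneg ‖M • v - ((2 + lam * β) • v + γ • a)‖
    rw [norm_sub_sq_real, norm_smul, mul_pow, Real.norm_eq_abs, sq_abs, real_inner_smul_left,
      inner_add_right, real_inner_smul_right, real_inner_smul_right,
      real_inner_self_eq_norm_sq] at h4
    have e3 : 2 + lam * β = 1 + l := by rw [hl]; ring
    rw [e3] at h4 hN
    nlinarith
  have hp' : δ * (l * ‖v‖ ^ 2 + γ * inner ℝ v a - ‖a‖ ^ 2) - (1 - δ) * ‖v‖ ^ 2 ≤
      -(1 / 2) * ‖v‖ ^ 2 - 1 / (2 * M) * ‖a‖ ^ 2 := by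
    -- The factor `δ / M` turns `M + 1` into `1`, because `δ (M + 1) = 1`.
    have h8 := mul_le_mul_of_nonneg_left hp (show 0 ≤ δ / M by positivity)
    have e4 : 1 - δ = δ * M := by linarith
    have e5 : δ / M * (M * (l * ‖v‖ ^ 2 + γ * inner ℝ v a - ‖a‖ ^ 2 - M * ‖v‖ ^ 2)) =
        δ * (l * ‖v‖ ^ 2 + γ * inner ℝ v a - ‖a‖ ^ 2) - (1 - δ) * ‖v‖ ^ 2 := by
      rw [e4]; field_simp
    have e6 : δ / M * (-(1 / 2) * (M + 1) * (M * ‖v‖ ^ 2 + ‖a‖ ^ 2)) =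
        -(1 / 2) * ‖v‖ ^ 2 - 1 / (2 * M) * ‖a‖ ^ 2 := by
      calc _ = -(1 / 2) * (δ * (M + 1)) * (‖v‖ ^ 2 + 1 / M * ‖a‖ ^ 2) := by field_simp
        _ = _ := by rw [hδ']; field_simp; ring
    rw [e5, e6] at h8
    exact h8
  have hs' := mul_le_mul_of_nonneg_left hs hβ
  have hp'' := mul_le_mul_of_nonneg_left hp' (show 0 ≤ γ / lam by positivity)
  calc _ = β * (‖a + γ • v‖ * (l * ‖v‖) - 3 * γ * inner ℝ v a) +
      γ / lam * (δ * (l * ‖v‖ ^ 2 + γ * inner ℝ v a - ‖a‖ ^ 2) - (1 - δ) * ‖v‖ ^ 2) := by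
        field_simp
        ring
    _ ≤ _ := add_le_add hs' hp''
    _ = _ := by field_simp; ring

/-- The curve `x'' + γ x' + x`. -/
def proxCurve (γ : ℝ) (x : ℝ → E) (t : ℝ) : E := acc x t + γ • vel x t + x t

/-- The curve `-(x'' + γ x') / lam - ∇g(x)`. -/
def subgradCurve [CompleteSpace E] (γ lam : ℝ) (g : E → ℝ) (x : ℝ → E) (t : ℝ) : E :=
  -(1 / lam) • (acc x t + γ • vel x t) - gradient g (x t)

/-- The regularized objective along the trajectory. -/
def energy (β γ lam : ℝ) (f : E → EReal) (g : E → ℝ) (x : ℝ → E) (t : ℝ) : ℝ :=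
  (f (proxCurve γ x t)).toReal + g (proxCurve γ x t) +
    1 / (2 * lam) * ‖acc x t + ((1 - weight β γ lam) * γ) • vel x t‖ ^ 2 -
    constC β γ lam / (2 * lam) * ‖vel x t‖ ^ 2

/-- What the energy estimates use about a trajectory of the proximal-gradient system. -/
structure IsProxFlow [CompleteSpace E] (β γ lam : ℝ) (f : E → EReal) (g : E → ℝ)
    (x : ℝ → E) : Prop where
  hasDerivWithinAt : ∀ t, 0 ≤ t → HasDerivWithinAt x (vel x t) (Ici 0) t
  hasDerivWithinAt_vel : ∀ t, 0 ≤ t → HasDerivWithinAt (vel x) (acc x t) (Ici 0) t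
  continuousOn_acc : ContinuousOn (acc x) (Ici 0)
  isSubgradient : ∀ t, 0 ≤ t → IsSubgradient f (proxCurve γ x t) (subgradCurve γ lam g x t)
  norm_proxCurve_sub_le : ∀ s t, 0 ≤ s → 0 ≤ t →
    ‖proxCurve γ x s - proxCurve γ x t‖ ≤ (1 + lam * β) * ‖x s - x t‖

namespace IsProxFlow

variable [CompleteSpace E]

theorem continuousOn (hx : IsProxFlow β γ lam f g x) : ContinuousOn x (Ici 0) :=
  fun t ht => (hx.hasDerivWithinAt t ht).continuousWithinAt

theorem continuousOn_vel (hx : IsProxFlow β γ lam f g x) : ContinuousOn (vel x) (Ici 0) :=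
  fun t ht => (hx.hasDerivWithinAt_vel t ht).continuousWithinAt

theorem continuousOn_proxCurve (hx : IsProxFlow β γ lam f g x) :
    ContinuousOn (proxCurve γ x) (Ici 0) :=
  (hx.continuousOn_acc.add (hx.continuousOn_vel.const_smul γ)).add hx.continuousOn

theorem continuousOn_subgradCurve (hx : IsProxFlow β γ lam f g x) (hg : Continuous (gradient g)) :
    ContinuousOn (subgradCurve γ lam g x) (Ici 0) :=
  ((hx.continuousOn_acc.add (hx.continuousOn_vel.const_smul γ)).const_smul _).sub
    (hg.comp_continuousOn hx.continuousOn)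

theorem toReal_sub_le (hx : IsProxFlow β γ lam f g x) (hb : ∀ u, f u ≠ ⊥) {s t : ℝ}
    (hs : 0 ≤ s) (ht : 0 ≤ t) : (f (proxCurve γ x s)).toReal - (f (proxCurve γ x t)).toReal ≤
      inner ℝ (subgradCurve γ lam g x s) (proxCurve γ x s - proxCurve γ x t) := by
  have h1 := (hx.isSubgradient s hs).2 (proxCurve γ x t)
  lift f (proxCurve γ x s) to ℝ using ⟨(hx.isSubgradient s hs).1, hb _⟩ with fs
  lift f (proxCurve γ x t) to ℝ using ⟨(hx.isSubgradient t ht).1, hb _⟩ with ft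
  norm_cast at h1
  rw [← neg_sub (proxCurve γ x s), inner_neg_right] at h1
  simp only [EReal.toReal_coe]
  linarith

/-- Although `f` is only lower semicontinuous, the subgradient inequalities at times `s` and `t`
squeeze `f(y s)` between two expressions tending to `f(y t)`. -/
theorem continuousOn_energy (hx : IsProxFlow β γ lam f g x) (hb : ∀ u, f u ≠ ⊥)
    (hg : Differentiable ℝ g) (hg' : Continuous (gradient g)) :
    ContinuousOn (energy β γ lam f g x) (Ici 0) := by
  have hy := hx.continuousOn_proxCurve
  have hw := hx.continuousOn_subgradCurve hg'
  have hF : ContinuousOn (fun t => (f (proxCurve γ x t)).toReal) (Ici 0) := by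
    intro t ht
    have hlow : Tendsto (fun s => (f (proxCurve γ x t)).toReal -
        inner ℝ (subgradCurve γ lam g x t) (proxCurve γ x t - proxCurve γ x s)) (𝓝[Ici 0] t)
        (𝓝 (f (proxCurve γ x t)).toReal) := by
      have : Tendsto (proxCurve γ x) (𝓝[Ici 0] t) _ := hy t ht
      simpa using tendsto_const_nhds.sub
        ((tendsto_const_nhds (x := subgradCurve γ lam g x t)).inner (𝕜 := ℝ)
          ((tendsto_const_nhds (x := proxCurve γ x t)).sub this))
    have hup : Tendsto (fun s => (f (proxCurve γ x t)).toReal +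
        inner ℝ (subgradCurve γ lam g x s) (proxCurve γ x s - proxCurve γ x t)) (𝓝[Ici 0] t)
        (𝓝 (f (proxCurve γ x t)).toReal) := by
      have h1 : Tendsto (proxCurve γ x) (𝓝[Ici 0] t) _ := hy t ht
      have h2 : Tendsto (subgradCurve γ lam g x) (𝓝[Ici 0] t) _ := hw t ht
      simpa using (tendsto_const_nhds (x := (f (proxCurve γ x t)).toReal)).add
        (h2.inner (𝕜 := ℝ) (h1.sub_const (proxCurve γ x t)))
    refine tendsto_of_tendsto_of_tendsto_of_le_of_le' hlow hup ?_ ?_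
    · filter_upwards [self_mem_nhdsWithin] with s hs
      have := hx.toReal_sub_le hb ht hs
      linarith
    · filter_upwards [self_mem_nhdsWithin] with s hs
      have := hx.toReal_sub_le hb hs ht
      linarith
  refine ((hF.add (hg.continuous.comp_continuousOn hy)).add (continuousOn_const.mul ?_)).sub
    (continuousOn_const.mul (hx.continuousOn_vel.norm.pow 2))
  exact (hx.continuousOn_acc.add (hx.continuousOn_vel.const_smul _)).norm.pow 2

theorem isLittleO (hx : IsProxFlow β γ lam f g x) {t : ℝ} (ht : 0 ≤ t) :
    (fun s => x s - x t - (s - t) • vel x t) =o[𝓝[>] t] fun s => s - t :=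
  (hasDerivWithinAt_iff_isLittleO.1 (hx.hasDerivWithinAt t ht)).mono
    (nhdsWithin_mono _ fun _ hs => ht.trans (le_of_lt hs))

theorem isBigO_proxCurve (hx : IsProxFlow β γ lam f g x) {t : ℝ} (ht : 0 ≤ t) :
    (fun s => proxCurve γ x s - proxCurve γ x t) =O[𝓝[>] t] fun s => s - t := by
  have h1 : (fun s => x s - x t) =O[𝓝[>] t] fun s => s - t := by
    have := (hx.isLittleO ht).isBigO.add
      (IsBigO.of_bound (g := fun s : ℝ => s - t) (f := fun s => (s - t) • vel x t) ‖vel x t‖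
        (Eventually.of_forall fun s => by rw [norm_smul, mul_comm]))
    simpa using this
  refine IsBigO.trans (IsBigO.of_bound (1 + lam * β) ?_) h1
  filter_upwards [self_mem_nhdsWithin] with s hs
  exact hx.norm_proxCurve_sub_le s t (ht.trans (le_of_lt hs)) ht

/-- All first-order terms in the increment of `y` are collected against one vector `W`, which is
small because it equals `∇g(y) - ∇g(x) - (γ δ / lam) v`. Hence a norm bound on that increment is
enough, and only `x` and `v` have to be differentiated. -/
theorem energy_dini (hx : IsProxFlow β γ lam f g x) (hb : ∀ u, f u ≠ ⊥)
    (hg : Differentiable ℝ g) (hβ : 0 ≤ β)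
    (hgβ : ∀ x y, ‖gradient g x - gradient g y‖ ≤ β * ‖x - y‖) (hγ : 0 < γ) (hlam : 0 < lam)
    {t : ℝ} (ht : 0 ≤ t) {ε : ℝ} (hε : 0 < ε) :
    ∀ᶠ s in 𝓝[>] t, energy β γ lam f g x s - energy β γ lam f g x t ≤
      (constA β γ lam * ‖vel x t‖ ^ 2 + constB β γ lam * ‖acc x t‖ ^ 2 + ε) * (s - t) := by
  have hsub : 𝓝[>] t ≤ 𝓝[Ici 0] t := nhdsWithin_mono _ fun _ hs => ht.trans (le_of_lt hs)
  have hg' : Continuous (gradient g) := (LipschitzWith.of_dist_le_mul (K := ⟨β, hβ⟩) fun u w => by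
    rw [dist_eq_norm, dist_eq_norm]; exact hgβ u w).continuous
  set δ := weight β γ lam with hδ
  set y := proxCurve γ x with hy
  set w := subgradCurve γ lam g x with hw
  set q : ℝ → E := fun s => x s + (δ * γ) • vel x s with hq
  set C := constC β γ lam with hC
  set v := vel x t with hv
  set a := acc x t with ha
  set W : E := w t + gradient g (y t) + (1 / lam) • (y t - q t) with hW
  set q' : E := v + (δ * γ) • a with hq'
  have hyq : ∀ s, y s - q s = acc x s + ((1 - δ) * γ) • vel x s := fun s => by
    simp only [hy, hq, proxCurve]; module
  have hΔy := hx.isBigO_proxCurve ht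
  have hΔx := hx.isLittleO ht
  have o1 : (fun s => inner ℝ (w s - w t) (y s - y t)) =o[𝓝[>] t] fun s => s - t := by
    have h1 : Tendsto (fun s => ‖w s - w t‖) (𝓝[>] t) (𝓝 0) := by
      have : Tendsto w (𝓝[>] t) (𝓝 (w t)) := (hx.continuousOn_subgradCurve hg' t ht).mono_left hsub
      exact tendsto_iff_norm_sub_tendsto_zero.1 this
    have h2 := ((isLittleO_one_iff ℝ).2 h1).mul_isBigO hΔy.norm_left
    simp only [one_mul] at h2
    refine IsBigO.trans_isLittleO (IsBigO.of_bound 1 (Eventually.of_forall fun s => ?_)) h2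
    rw [one_mul, norm_mul, norm_norm, norm_norm]
    exact norm_inner_le_norm _ _
  have o2 : (fun s => g (y s) - g (y t) - inner ℝ (gradient g (y t)) (y s - y t))
      =o[𝓝[>] t] fun s => s - t := by
    have h1 : Tendsto y (𝓝[>] t) (𝓝 (y t)) := (hx.continuousOn_proxCurve t ht).mono_left hsub
    have h2 := (hasGradientAt_iff_isLittleO.1 (hg (y t)).hasGradientAt).comp_tendsto h1
    exact h2.trans_isBigO hΔy
  have hdq : (fun s => q s - q t - (s - t) • q') =o[𝓝[>] t] fun s => s - t :=
    (hasDerivWithinAt_iff_isLittleO.1 ((hx.hasDerivWithinAt t ht).add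
      ((hx.hasDerivWithinAt_vel t ht).const_smul (δ * γ)))).mono hsub
  have o3 : (fun s => ‖(y s - y t) - (q s - q t)‖ ^ 2) =o[𝓝[>] t] fun s => s - t := by
    have h1 : (fun s => q s - q t) =O[𝓝[>] t] fun s => s - t := by
      have := hdq.isBigO.add
        (IsBigO.of_bound (g := fun s : ℝ => s - t) (f := fun s => (s - t) • q') ‖q'‖
          (Eventually.of_forall fun s => by rw [norm_smul, mul_comm]))
      simpa using this
    refine IsBigO.trans_isLittleO ((hΔy.sub h1).norm_left.pow 2) ?_
    have h2 : (fun s : ℝ => s - t) =o[𝓝[>] t] fun _ => (1 : ℝ) := by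
      refine (isLittleO_one_iff ℝ).2 ?_
      have : Continuous fun s : ℝ => s - t := by fun_prop
      simpa using (this.tendsto t).mono_left nhdsWithin_le_nhds
    simpa [sq] using h2.mul_isBigO (isBigO_refl (fun s : ℝ => s - t) (𝓝[>] t))
  have o4 : (fun s => inner ℝ (y t - q t) (q s - q t - (s - t) • q')) =o[𝓝[>] t]
      fun s => s - t := by
    refine IsBigO.trans_isLittleO (IsBigO.of_bound ‖y t - q t‖ (Eventually.of_forall fun s => ?_))
      hdq
    exact norm_inner_le_norm _ _
  have o5 : (fun s => ‖vel x s‖ ^ 2 - ‖v‖ ^ 2 - (s - t) * (2 * inner ℝ v a)) =o[𝓝[>] t]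
      fun s => s - t :=
    (hasDerivWithinAt_iff_isLittleO.1 (hx.hasDerivWithinAt_vel t ht).norm_sq).mono hsub
  -- Every remainder of the expansion at once, including the linearization error of `x` that enters
  -- through `‖W‖`.
  have hsum := ((((o1.add o2).add (o3.const_mul_left (1 / (2 * lam)))).sub
    (o4.const_mul_left (1 / lam))).sub (o5.const_mul_left (C / (2 * lam)))).add
    (hΔx.norm_left.const_mul_left (‖W‖ * (1 + lam * β)))
  have hWle : ‖W‖ ≤ β * ‖a + γ • v‖ + γ * δ / lam * ‖v‖ := by
    have e : W = (gradient g (y t) - gradient g (x t)) - (γ * δ / lam) • v := by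
      rw [hW, hyq]
      simp only [hw, subgradCurve, ← ha, ← hv]
      module
    have h1 := hgβ (y t) (x t)
    have e2 : y t - x t = a + γ • v := by simp only [hy, proxCurve]; module
    rw [e2] at h1
    have hδ0 : 0 ≤ δ := by rw [hδ, weight]; positivity
    calc ‖W‖ ≤ ‖gradient g (y t) - gradient g (x t)‖ + ‖(γ * δ / lam) • v‖ := by
          rw [e]; exact norm_sub_le _ _
      _ ≤ _ := by
          rw [norm_smul, Real.norm_of_nonneg (by positivity)]
          linarith
  have hdiss := dissipation_le hβ hγ hlam v a
  rw [← hδ, ← hC] at hdiss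
  filter_upwards [hsum.bound hε, self_mem_nhdsWithin] with s hs hts
  have hτ : 0 < s - t := sub_pos.2 hts
  have hs0 : 0 ≤ s := ht.trans (le_of_lt hts)
  rw [Real.norm_of_nonneg hτ.le] at hs
  have hs' := (le_abs_self _).trans hs
  have hF := hx.toReal_sub_le hb hs0 ht
  have hWD : inner ℝ W (y s - y t) ≤ ‖W‖ * (1 + lam * β) *
      ((s - t) * ‖v‖ + ‖x s - x t - (s - t) • v‖) := by
    have h1 : ‖x s - x t‖ ≤ (s - t) * ‖v‖ + ‖x s - x t - (s - t) • v‖ := by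
      calc ‖x s - x t‖ = ‖(s - t) • v + (x s - x t - (s - t) • v)‖ := by congr 1; abel
        _ ≤ _ := norm_add_le _ _
        _ = _ := by rw [norm_smul, Real.norm_of_nonneg hτ.le]
    have h2 := hx.norm_proxCurve_sub_le s t hs0 ht
    calc inner ℝ W (y s - y t) ≤ ‖W‖ * ‖y s - y t‖ := real_inner_le_norm _ _
      _ ≤ ‖W‖ * ((1 + lam * β) * ‖x s - x t‖) := by gcongr
      _ ≤ ‖W‖ * ((1 + lam * β) * ((s - t) * ‖v‖ + ‖x s - x t - (s - t) • v‖)) := by gcongr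
      _ = _ := by ring
  have hWv : ‖W‖ * (1 + lam * β) * ((s - t) * ‖v‖) ≤
      (s - t) * ((β * ‖a + γ • v‖ + γ * δ / lam * ‖v‖) * ((1 + lam * β) * ‖v‖)) := by
    have := mul_le_mul_of_nonneg_right hWle (show 0 ≤ (1 + lam * β) * ((s - t) * ‖v‖) by positivity)
    linarith
  have hdiss' := mul_le_mul_of_nonneg_left hdiss hτ.le
  have hsq : ‖y s - q s‖ ^ 2 = ‖y t - q t‖ ^ 2 + 2 * (inner ℝ (y t - q t) (y s - y t)
      - inner ℝ (y t - q t) (q s - q t)) + ‖(y s - y t) - (q s - q t)‖ ^ 2 := by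
    rw [← inner_sub_right, ← norm_add_sq_real]
    congr 2; abel
  have eW : inner ℝ W (y s - y t) = inner ℝ (w t) (y s - y t) +
      inner ℝ (gradient g (y t)) (y s - y t) + 1 / lam * inner ℝ (y t - q t) (y s - y t) := by
    rw [hW, inner_add_left, inner_add_left, real_inner_smul_left]
  have ew : inner ℝ (w s) (y s - y t) = inner ℝ (w t) (y s - y t) +
      inner ℝ (w s - w t) (y s - y t) := by rw [← inner_add_left]; congr 1; abel
  have eq : inner ℝ (y t - q t) (q s - q t - (s - t) • q') = inner ℝ (y t - q t) (q s - q t) -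
      (s - t) * inner ℝ (y t - q t) q' := by rw [inner_sub_right, real_inner_smul_right]
  rw [eq] at hs'
  rw [ew] at hF
  rw [eW] at hWD
  rw [← hyq t, ← hq'] at hdiss'
  simp only [energy, ← hδ, ← hC]
  rw [← hyq, ← hyq, hsq]
  have e1 : 1 / (2 * lam) = 1 / lam / 2 := by ring
  have e2 : C / (2 * lam) = C / lam / 2 := by ring
  rw [e1, e2] at hs' ⊢
  linarith

end IsProxFlow
end Energy

/-! ### Decay of energy, velocity and acceleration -/

namespace IsProxFlow

variable {E : Type*} [NormedAddCommGroup E] [InnerProductSpace ℝ E] [CompleteSpace E]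
variable {β γ lam : ℝ} {f : E → EReal} {g : E → ℝ} {x : ℝ → E}

/-- A Grönwall-type bound: increments of `a` are those of `y - γ v - x`, so `a` is Lipschitz to
first order with constants governed by `‖v‖` and `‖a‖` themselves. -/
theorem speed_dini (hx : IsProxFlow β γ lam f g x) (hβ : 0 ≤ β) (hγ : 0 < γ) (hlam : 0 < lam)
    {t : ℝ} (ht : 0 ≤ t) {ε : ℝ} (hε : 0 < ε) :
    ∀ᶠ s in 𝓝[>] t, (‖vel x s‖ ^ 2 + ‖acc x s‖ ^ 2) - (‖vel x t‖ ^ 2 + ‖acc x t‖ ^ 2) ≤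
      ((3 + lam * β + 2 * γ) * (‖vel x t‖ ^ 2 + ‖acc x t‖ ^ 2) + ε) * (s - t) := by
  have hsub : 𝓝[>] t ≤ 𝓝[Ici 0] t := nhdsWithin_mono _ fun _ hs => ht.trans (le_of_lt hs)
  have hm : 0 ≤ lam * β := by positivity
  set m := lam * β with hm_def
  set v := vel x t with hv
  set a := acc x t with ha
  have o1 := hx.isLittleO ht
  have o2 : (fun s => vel x s - v - (s - t) • a) =o[𝓝[>] t] fun s => s - t :=
    (hasDerivWithinAt_iff_isLittleO.1 (hx.hasDerivWithinAt_vel t ht)).mono hsub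
  have o3 : (fun s => ‖vel x s‖ ^ 2 - ‖v‖ ^ 2 - (s - t) * (2 * inner ℝ v a)) =o[𝓝[>] t]
      fun s => s - t :=
    (hasDerivWithinAt_iff_isLittleO.1 (hx.hasDerivWithinAt_vel t ht).norm_sq).mono hsub
  have hvO : (fun s => vel x s - v) =O[𝓝[>] t] fun s => s - t := by
    have := o2.isBigO.add
      (IsBigO.of_bound (g := fun s : ℝ => s - t) (f := fun s => (s - t) • a) ‖a‖
        (Eventually.of_forall fun s => by rw [norm_smul, mul_comm]))
    simpa using this
  have hxO : (fun s => x s - x t) =O[𝓝[>] t] fun s => s - t := by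
    have := o1.isBigO.add
      (IsBigO.of_bound (g := fun s : ℝ => s - t) (f := fun s => (s - t) • v) ‖v‖
        (Eventually.of_forall fun s => by rw [norm_smul, mul_comm]))
    simpa [hv] using this
  have haO : (fun s => acc x s - a) =O[𝓝[>] t] fun s => s - t := by
    have := ((hx.isBigO_proxCurve ht).sub (hvO.const_smul_left γ)).sub hxO
    refine this.congr_left fun s => ?_
    simp only [proxCurve, Pi.smul_apply]
    module
  have o4 : (fun s => ‖acc x s - a‖ ^ 2) =o[𝓝[>] t] fun s => s - t := by
    refine IsBigO.trans_isLittleO (haO.norm_left.pow 2) ?_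
    have h2 : (fun s : ℝ => s - t) =o[𝓝[>] t] fun _ => (1 : ℝ) := by
      refine (isLittleO_one_iff ℝ).2 ?_
      have : Continuous fun s : ℝ => s - t := by fun_prop
      simpa using (this.tendsto t).mono_left nhdsWithin_le_nhds
    simpa [sq] using h2.mul_isBigO (isBigO_refl (fun s : ℝ => s - t) (𝓝[>] t))
  have hsum := ((o3.add o4).add (o1.norm_left.const_mul_left (2 * ‖a‖ * (2 + m)))).add
    (o2.norm_left.const_mul_left (2 * ‖a‖ * γ))
  filter_upwards [hsum.bound hε, self_mem_nhdsWithin] with s hs hts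
  have hτ : 0 < s - t := sub_pos.2 hts
  rw [Real.norm_of_nonneg hτ.le] at hs
  have hs' := (le_abs_self _).trans hs
  have hΔx : ‖x s - x t‖ ≤ (s - t) * ‖v‖ + ‖x s - x t - (s - t) • v‖ := by
    calc ‖x s - x t‖ = ‖(s - t) • v + (x s - x t - (s - t) • v)‖ := by congr 1; abel
      _ ≤ _ := norm_add_le _ _
      _ = _ := by rw [norm_smul, Real.norm_of_nonneg hτ.le]
  have hΔv : ‖vel x s - v‖ ≤ (s - t) * ‖a‖ + ‖vel x s - v - (s - t) • a‖ := by
    calc ‖vel x s - v‖ = ‖(s - t) • a + (vel x s - v - (s - t) • a)‖ := by congr 1; abel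
      _ ≤ _ := norm_add_le _ _
      _ = _ := by rw [norm_smul, Real.norm_of_nonneg hτ.le]
  have hΔa : ‖acc x s - a‖ ≤ (2 + m) * ‖x s - x t‖ + γ * ‖vel x s - v‖ := by
    have e : acc x s - a = (proxCurve γ x s - proxCurve γ x t) - γ • (vel x s - v) -
        (x s - x t) := by simp only [proxCurve]; module
    have h1 := hx.norm_proxCurve_sub_le s t (ht.trans (le_of_lt hts)) ht
    have h2 : ‖acc x s - a‖ ≤ ‖proxCurve γ x s - proxCurve γ x t‖ + ‖γ • (vel x s - v)‖ +
        ‖x s - x t‖ := by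
      rw [e]
      exact (norm_sub_le _ _).trans (add_le_add_left (norm_sub_le _ _) _)
    rw [norm_smul, Real.norm_of_nonneg hγ.le] at h2
    linarith
  have hasq : ‖acc x s‖ ^ 2 = ‖a‖ ^ 2 + 2 * inner ℝ a (acc x s - a) + ‖acc x s - a‖ ^ 2 := by
    rw [← norm_add_sq_real]; congr 2; abel
  have hin : inner ℝ a (acc x s - a) ≤ ‖a‖ *
      ((2 + m) * ((s - t) * ‖v‖ + ‖x s - x t - (s - t) • v‖) +
        γ * ((s - t) * ‖a‖ + ‖vel x s - v - (s - t) • a‖)) := by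
    refine (real_inner_le_norm _ _).trans (mul_le_mul_of_nonneg_left ?_ (norm_nonneg _))
    refine hΔa.trans ?_
    gcongr
  have hva : 2 * (‖v‖ * ‖a‖) ≤ ‖v‖ ^ 2 + ‖a‖ ^ 2 := by nlinarith [sq_nonneg (‖v‖ - ‖a‖)]
  have hmain : 2 * inner ℝ v a + 2 * ‖a‖ * ((2 + m) * ‖v‖ + γ * ‖a‖) ≤
      (3 + m + 2 * γ) * (‖v‖ ^ 2 + ‖a‖ ^ 2) := by
    have h1 := real_inner_le_norm v a
    have h2 := mul_le_mul_of_nonneg_left hva (show 0 ≤ 3 + m by linarith)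
    have h3 := mul_nonneg hγ.le (sq_nonneg ‖v‖)
    nlinarith
  have hmain' := mul_le_mul_of_nonneg_right hmain hτ.le
  rw [hasq]
  linarith

theorem continuousOn_speed (hx : IsProxFlow β γ lam f g x) :
    ContinuousOn (fun t => ‖vel x t‖ ^ 2 + ‖acc x t‖ ^ 2) (Ici 0) :=
  (hx.continuousOn_vel.norm.pow 2).add (hx.continuousOn_acc.norm.pow 2)

theorem speed_le (hx : IsProxFlow β γ lam f g x) (hβ : 0 ≤ β) (hγ : 0 < γ) (hlam : 0 < lam)
    {t : ℝ} (ht : 1 ≤ t) : ‖vel x t‖ ^ 2 + ‖acc x t‖ ^ 2 ≤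
      (1 + (3 + lam * β + 2 * γ)) * ∫ r in (t - 1)..t, ‖vel x r‖ ^ 2 + ‖acc x r‖ ^ 2 := by
  have hsub : ∀ {s : ℝ}, t - 1 ≤ s → Icc s t ⊆ Ici 0 := fun hs r hr => by
    have := hr.1
    simp only [mem_Ici]; linarith
  refine le_integral_of_sub_le_integral (h := fun r => ‖vel x r‖ ^ 2 + ‖acc x r‖ ^ 2)
    (by positivity) (fun s => by positivity)
    (hx.continuousOn_speed.mono (hsub le_rfl)) fun s hs => ?_
  exact sub_le_integral_of_dini hs.2 (hx.continuousOn_speed.mono (hsub hs.1))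
    (continuousOn_const.mul (hx.continuousOn_speed.mono (hsub hs.1)))
    fun r hr ε hε => hx.speed_dini hβ hγ hlam (hsub hs.1 ⟨hr.1, hr.2.le⟩) hε

theorem energy_dini_neg (hx : IsProxFlow β γ lam f g x) (hb : ∀ u, f u ≠ ⊥)
    (hg : Differentiable ℝ g) (hβ : 0 ≤ β)
    (hgβ : ∀ x y, ‖gradient g x - gradient g y‖ ≤ β * ‖x - y‖) (hγ : 0 < γ) (hlam : 0 < lam)
    {c : ℝ} (hA : constA β γ lam ≤ -c) (hB : constB β γ lam ≤ -c)
    {t : ℝ} (ht : 0 ≤ t) {ε : ℝ} (hε : 0 < ε) :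
    ∀ᶠ s in 𝓝[>] t, energy β γ lam f g x s - energy β γ lam f g x t ≤
      (-c * (‖vel x t‖ ^ 2 + ‖acc x t‖ ^ 2) + ε) * (s - t) := by
  filter_upwards [hx.energy_dini hb hg hβ hgβ hγ hlam ht hε, self_mem_nhdsWithin] with s hs hts
  refine hs.trans (mul_le_mul_of_nonneg_right ?_ (sub_nonneg.2 (le_of_lt hts)))
  have h1 := mul_le_mul_of_nonneg_right hA (sq_nonneg ‖vel x t‖)
  have h2 := mul_le_mul_of_nonneg_right hB (sq_nonneg ‖acc x t‖)
  linarith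

theorem energy_sub_le (hx : IsProxFlow β γ lam f g x) (hb : ∀ u, f u ≠ ⊥)
    (hg : Differentiable ℝ g) (hβ : 0 ≤ β)
    (hgβ : ∀ x y, ‖gradient g x - gradient g y‖ ≤ β * ‖x - y‖) (hγ : 0 < γ) (hlam : 0 < lam)
    {c : ℝ} (hA : constA β γ lam ≤ -c) (hB : constB β γ lam ≤ -c)
    {s t : ℝ} (hs : 0 ≤ s) (hst : s ≤ t) :
    energy β γ lam f g x t - energy β γ lam f g x s ≤
      -c * ∫ r in s..t, ‖vel x r‖ ^ 2 + ‖acc x r‖ ^ 2 := by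
  have hsub : Icc s t ⊆ Ici 0 := fun r hr => hs.trans hr.1
  have hg' : Continuous (gradient g) := (LipschitzWith.of_dist_le_mul (K := ⟨β, hβ⟩) fun u w => by
    rw [dist_eq_norm, dist_eq_norm]; exact hgβ u w).continuous
  rw [← intervalIntegral.integral_const_mul]
  exact sub_le_integral_of_dini hst ((hx.continuousOn_energy hb hg hg').mono hsub)
    (continuousOn_const.mul (hx.continuousOn_speed.mono hsub))
    fun r hr ε hε => hx.energy_dini_neg hb hg hβ hgβ hγ hlam hA hB (hs.trans hr.1) hε

theorem le_energy (hx : IsProxFlow β γ lam f g x) (hb : ∀ u, f u ≠ ⊥) (hlam : 0 < lam)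
    (hC : constC β γ lam ≤ 0) {m : ℝ} (hm : ∀ u, (m : EReal) ≤ addFun f g u) {t : ℝ}
    (ht : 0 ≤ t) : m ≤ energy β γ lam f g x t := by
  have h1 := hm (proxCurve γ x t)
  rw [addFun] at h1
  rw [energy]
  lift f (proxCurve γ x t) to ℝ using ⟨(hx.isSubgradient t ht).1, hb _⟩ with fs
  norm_cast at h1
  rw [EReal.toReal_coe]
  have h2 : 0 ≤ 1 / (2 * lam) * ‖acc x t + ((1 - weight β γ lam) * γ) • vel x t‖ ^ 2 := by
    positivity
  have h3 : constC β γ lam / (2 * lam) * ‖vel x t‖ ^ 2 ≤ 0 :=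
    mul_nonpos_of_nonpos_of_nonneg (div_nonpos_of_nonpos_of_nonneg hC (by positivity))
      (sq_nonneg _)
  linarith

/-- The energy decreases to a limit, and velocity and acceleration vanish asymptotically. -/
theorem exists_tendsto_energy (hx : IsProxFlow β γ lam f g x) (hb : ∀ u, f u ≠ ⊥)
    (hg : Differentiable ℝ g) (hβ : 0 ≤ β)
    (hgβ : ∀ x y, ‖gradient g x - gradient g y‖ ≤ β * ‖x - y‖) (hγ : 0 < γ) (hlam : 0 < lam)
    {c : ℝ} (hc : 0 < c) (hA : constA β γ lam ≤ -c) (hB : constB β γ lam ≤ -c)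
    (hC : constC β γ lam ≤ 0) {m : ℝ} (hm : ∀ u, (m : EReal) ≤ addFun f g u) :
    ∃ e : ℝ, (∀ t, 0 ≤ t → e ≤ energy β γ lam f g x t) ∧
      Tendsto (energy β γ lam f g x) atTop (𝓝 e) ∧
      Tendsto (vel x) atTop (𝓝 0) ∧ Tendsto (acc x) atTop (𝓝 0) := by
  set en := energy β γ lam f g x with hen
  have hdec : ∀ s t, 0 ≤ s → s ≤ t →
      c * ∫ r in s..t, (‖vel x r‖ ^ 2 + ‖acc x r‖ ^ 2) ≤ en s - en t := fun s t hs hst => by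
    have := hx.energy_sub_le hb hg hβ hgβ hγ hlam hA hB hs hst
    linarith
  have hanti : ∀ s t, 0 ≤ s → s ≤ t → en t ≤ en s := fun s t hs hst => by
    have h1 := hdec s t hs hst
    have h2 : 0 ≤ ∫ r in s..t, (‖vel x r‖ ^ 2 + ‖acc x r‖ ^ 2) :=
      intervalIntegral.integral_nonneg hst fun r _ => by positivity
    nlinarith
  -- Monotonicity is known only for nonnegative times, hence the truncation.
  have hmono : Antitone fun t => en (max t 0) := fun s t hst =>
    hanti _ _ (le_max_right _ _) (max_le_max_right _ hst)
  have hbdd : BddBelow (range fun t => en (max t 0)) :=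
    ⟨m, by rintro _ ⟨t, rfl⟩; exact hx.le_energy hb hlam hC hm (le_max_right _ _)⟩
  have hlim : Tendsto en atTop (𝓝 (⨅ t, en (max t 0))) := by
    refine (tendsto_atTop_ciInf hmono hbdd).congr' ?_
    filter_upwards [eventually_ge_atTop 0] with t ht
    rw [max_eq_left ht]
  -- The energy drop over `[t - 1, t]` dominates the integral there, and it tends to `0`.
  have hsp : Tendsto (fun t => ‖vel x t‖ ^ 2 + ‖acc x t‖ ^ 2) atTop (𝓝 0) := by
    have h1 : Tendsto (fun t => (1 + (3 + lam * β + 2 * γ)) / c * (en (t - 1) - en t)) atTop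
        (𝓝 0) := by
      have h2 : Tendsto (fun t : ℝ => t - 1) atTop atTop := tendsto_atTop_add_const_right _ _ tendsto_id
      simpa using ((hlim.comp h2).sub hlim).const_mul ((1 + (3 + lam * β + 2 * γ)) / c)
    refine tendsto_of_tendsto_of_tendsto_of_le_of_le' tendsto_const_nhds h1
      (Eventually.of_forall fun t => by positivity) ?_
    filter_upwards [eventually_ge_atTop 1] with t ht
    refine (hx.speed_le hβ hγ hlam ht).trans ?_
    rw [div_mul_eq_mul_div, mul_div_assoc]
    refine mul_le_mul_of_nonneg_left ?_ (by positivity)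
    rw [le_div_iff₀ hc, mul_comm]
    exact hdec _ _ (by linarith) (by linarith)
  have hsqrt : Tendsto (fun t => √(‖vel x t‖ ^ 2 + ‖acc x t‖ ^ 2)) atTop (𝓝 0) := by
    simpa using hsp.sqrt
  refine ⟨_, fun t ht => ?_, hlim, ?_, ?_⟩
  · have := ciInf_le hbdd t
    simpa [max_eq_left ht] using this
  · exact squeeze_zero_norm (fun t => Real.le_sqrt_of_sq_le (le_add_of_nonneg_right (sq_nonneg _)))
      hsqrt
  · exact squeeze_zero_norm (fun t => Real.le_sqrt_of_sq_le (le_add_of_nonneg_left (sq_nonneg _)))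
      hsqrt

end IsProxFlow

/-! ### Subgradients of `H` and the KL length estimate -/

section Regularization

variable {E : Type*} [NormedAddCommGroup E] [InnerProductSpace ℝ E] [CompleteSpace E]
variable {β γ lam : ℝ} {f : E → EReal} {g : E → ℝ} {x : ℝ → E}

theorem IsSubgradient.mem_limitingSubdiff_addFun (hb : ∀ u, f u ≠ ⊥) (hg : Differentiable ℝ g)
    {u p : E} (hp : IsSubgradient f u p) : p + gradient g u ∈ limitingSubdiff (addFun f g) u :=
  hp.add_mem_limitingSubdiff hb (hg u).hasGradientAt.hasFDerivAt fun d => by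
    rw [inner_add_left, InnerProductSpace.toDual_apply_apply]

theorem IsSubgradient.mem_limitingSubdiff_regularization (hb : ∀ u, f u ≠ ⊥)
    (hg : Differentiable ℝ g) {u p : E} (hp : IsSubgradient f u p) (lam C : ℝ) (v w : E) :
    WithLp.toLp 2 ![p + gradient g u + (1 / lam) • (u - v), -(1 / lam) • (u - v), -(C / lam) • w]
      ∈ limitingSubdiff (regularization lam C f g) (WithLp.toLp 2 ![u, v, w]) := by
  set z : PiLp 2 (fun _ : Fin 3 => E) := WithLp.toLp 2 ![u, v, w] with hz
  have hz0 : z 0 = u := rfl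
  have hz1 : z 1 = v := rfl
  have hz2 : z 2 = w := rfl
  -- Splitting into a nonsmooth convex part in the first coordinate and a differentiable remainder
  -- makes the sum rule applicable.
  have hreg : regularization lam C f g = addFun (fun z : PiLp 2 (fun _ : Fin 3 => E) => f (z 0))
      (fun z => g (z 0) + (1 / (2 * lam) * ‖z 0 - z 1‖ ^ 2 - C / (2 * lam) * ‖z 2‖ ^ 2)) := by
    funext z
    simp only [regularization, addFun]
    rw [add_assoc, ← EReal.coe_add]
  rw [hreg]
  have hω : IsSubgradient (fun z : PiLp 2 (fun _ : Fin 3 => E) => f (z 0)) z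
      (WithLp.toLp 2 ![p, 0, 0]) := by
    refine ⟨hp.1, fun y => ?_⟩
    have := hp.2 (y 0)
    simpa [PiLp.inner_apply, Fin.sum_univ_three, hz0] using this
  have d0 : HasFDerivAt (fun z : PiLp 2 (fun _ : Fin 3 => E) => z 0)
      (PiLp.proj (𝕜 := ℝ) 2 (fun _ : Fin 3 => E) 0) z := PiLp.hasFDerivAt_apply 2 z 0
  have d1 : HasFDerivAt (fun z : PiLp 2 (fun _ : Fin 3 => E) => z 1)
      (PiLp.proj (𝕜 := ℝ) 2 (fun _ : Fin 3 => E) 1) z := PiLp.hasFDerivAt_apply 2 z 1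
  have d2 : HasFDerivAt (fun z : PiLp 2 (fun _ : Fin 3 => E) => z 2)
      (PiLp.proj (𝕜 := ℝ) 2 (fun _ : Fin 3 => E) 2) z := PiLp.hasFDerivAt_apply 2 z 2
  have hgz : HasFDerivAt g (InnerProductSpace.toDual ℝ E (gradient g u)) (z 0) :=
    (hg u).hasGradientAt.hasFDerivAt
  refine hω.add_mem_limitingSubdiff (fun z => hb _) ((hgz.comp z d0).add
    (((d0.sub d1).norm_sq.const_mul (1 / (2 * lam))).sub
      (d2.norm_sq.const_mul (C / (2 * lam))))) fun d => ?_
  simp [PiLp.inner_apply, Fin.sum_univ_three, hz0, hz1, hz2, inner_add_left, inner_sub_left,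
    real_inner_smul_left, inner_neg_left]
  ring

theorem norm_toLp_three_le {F : Type*} [NormedAddCommGroup F] (p q r : F) :
    ‖(WithLp.toLp 2 ![p, q, r] : PiLp 2 (fun _ : Fin 3 => F))‖ ≤ ‖p‖ + ‖q‖ + ‖r‖ := by
  refine (sq_le_sq₀ (norm_nonneg _) (by positivity)).1 ?_
  rw [PiLp.norm_sq_eq_of_L2, Fin.sum_univ_three]
  have h1 := norm_nonneg p
  have h2 := norm_nonneg q
  have h3 := norm_nonneg r
  simp only [Matrix.cons_val]
  nlinarith [mul_nonneg h1 h2, mul_nonneg h1 h3, mul_nonneg h2 h3]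

/-- The point of the product space at which `regularization` equals the energy. -/
def lifted (β γ lam : ℝ) (x : ℝ → E) (t : ℝ) : PiLp 2 (fun _ : Fin 3 => E) :=
  WithLp.toLp 2 ![proxCurve γ x t, x t + (weight β γ lam * γ) • vel x t, vel x t]

namespace IsProxFlow

theorem regularization_lifted (hx : IsProxFlow β γ lam f g x) (hb : ∀ u, f u ≠ ⊥) {t : ℝ}
    (ht : 0 ≤ t) : regularization lam (constC β γ lam) f g (lifted β γ lam x t) =
      energy β γ lam f g x t := by
  have e : proxCurve γ x t - (x t + (weight β γ lam * γ) • vel x t) =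
      acc x t + ((1 - weight β γ lam) * γ) • vel x t := by
    simp only [proxCurve]; module
  simp only [regularization, lifted, addFun, Matrix.cons_val, energy]
  rw [e]
  lift f (proxCurve γ x t) to ℝ using ⟨(hx.isSubgradient t ht).1, hb _⟩ with fs
  rw [EReal.toReal_coe]
  norm_cast
  ring

/-- Since `y - x = a + γ v`, the explicit subgradient consists of multiples of `v` and `a` and of
`∇g(y) - ∇g(x)`, all linear in the speeds. -/
theorem exists_subgradient_bound (hx : IsProxFlow β γ lam f g x) (hb : ∀ u, f u ≠ ⊥)
    (hg : Differentiable ℝ g) (hβ : 0 ≤ β)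
    (hgβ : ∀ x y, ‖gradient g x - gradient g y‖ ≤ β * ‖x - y‖) (hγ : 0 < γ) (hlam : 0 < lam) :
    ∃ M, 0 < M ∧ ∀ t, 0 ≤ t →
      ∃ ξ ∈ limitingSubdiff (regularization lam (constC β γ lam) f g) (lifted β γ lam x t),
        ‖ξ‖ ≤ M * (‖vel x t‖ + ‖acc x t‖) := by
  set δ := weight β γ lam with hδ
  have hδ0 : 0 ≤ δ := by rw [hδ, weight]; positivity
  have hδ1 : δ ≤ 1 := by
    rw [hδ, weight, div_le_one (by positivity)]
    linarith [sq_nonneg (L β γ lam)]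
  set C := constC β γ lam
  refine ⟨(β * (1 + γ) + 2 * (1 / lam * (1 + γ)) + 1 / lam * (1 + γ)) + |C| / lam, by positivity,
    fun t ht => ⟨_, (hx.isSubgradient t ht).mem_limitingSubdiff_regularization hb hg _ _ _ _, ?_⟩⟩
  refine (norm_toLp_three_le _ _ _).trans ?_
  set v := vel x t with hv
  set a := acc x t with ha
  have e : proxCurve γ x t - (x t + (δ * γ) • v) = a + ((1 - δ) * γ) • v := by
    simp only [proxCurve, ← hv, ← ha]; module
  rw [e]
  have hn : ∀ r, 0 ≤ r → r ≤ γ → ‖a + r • v‖ ≤ (1 + γ) * (‖v‖ + ‖a‖) := fun r hr hrγ => by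
    have h1 := norm_add_le a (r • v)
    rw [norm_smul, Real.norm_of_nonneg hr] at h1
    have h2 := mul_le_mul_of_nonneg_right hrγ (norm_nonneg v)
    have h3 := mul_nonneg hγ.le (norm_nonneg a)
    linarith [norm_nonneg v]
  have hn1 := hn ((1 - δ) * γ) (mul_nonneg (by linarith) hγ.le) (by nlinarith)
  have hn2 := hn γ hγ.le le_rfl
  have hl : 0 < 1 / lam := by positivity
  have h1 : ‖(1 / lam) • (a + ((1 - δ) * γ) • v)‖ ≤ 1 / lam * ((1 + γ) * (‖v‖ + ‖a‖)) := by
    rw [norm_smul, Real.norm_of_nonneg hl.le]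
    gcongr
  have h2 : ‖subgradCurve γ lam g x t + gradient g (proxCurve γ x t)‖ ≤
      1 / lam * ((1 + γ) * (‖v‖ + ‖a‖)) + β * ((1 + γ) * (‖v‖ + ‖a‖)) := by
    have e2 : subgradCurve γ lam g x t + gradient g (proxCurve γ x t) =
        -((1 / lam) • (a + γ • v)) + (gradient g (proxCurve γ x t) - gradient g (x t)) := by
      simp only [subgradCurve, ← hv, ← ha]; module
    have e3 : proxCurve γ x t - x t = a + γ • v := by simp only [proxCurve, ← hv, ← ha]; module
    have h3 := hgβ (proxCurve γ x t) (x t)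
    rw [e3] at h3
    rw [e2]
    refine (norm_add_le _ _).trans (add_le_add ?_ (h3.trans (by gcongr)))
    rw [norm_neg, norm_smul, Real.norm_of_nonneg hl.le]
    gcongr
  have h4 : ‖-(C / lam) • v‖ ≤ |C| / lam * (‖v‖ + ‖a‖) := by
    rw [norm_smul, norm_neg, norm_div, Real.norm_eq_abs, Real.norm_of_nonneg hlam.le]
    gcongr
    linarith [norm_nonneg a]
  rw [neg_smul, norm_neg]
  have h5 := norm_add_le (subgradCurve γ lam g x t + gradient g (proxCurve γ x t))
    ((1 / lam) • (a + ((1 - δ) * γ) • v))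
  linarith

/-- Finite length of trajectories near a limit point with the Kurdyka–Łojasiewicz property. -/
theorem exists_length_bound (hx : IsProxFlow β γ lam f g x) (hb : ∀ u, f u ≠ ⊥)
    (hg : Differentiable ℝ g) (hβ : 0 ≤ β)
    (hgβ : ∀ x y, ‖gradient g x - gradient g y‖ ≤ β * ‖x - y‖) (hγ : 0 < γ) (hlam : 0 < lam)
    {c : ℝ} (hc : 0 < c) (hA : constA β γ lam ≤ -c) (hB : constB β γ lam ≤ -c)
    {e : ℝ} (he : ∀ t, 0 ≤ t → e ≤ energy β γ lam f g x t)
    (hlim : Tendsto (energy β γ lam f g x) atTop (𝓝 e))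
    (hv0 : Tendsto (vel x) atTop (𝓝 0)) (ha0 : Tendsto (acc x) atTop (𝓝 0))
    {xbar : E} {T : ℕ → ℝ} (hT : Tendsto T atTop atTop)
    (hxT : Tendsto (fun k => x (T k)) atTop (𝓝 xbar))
    (hbar : regularization lam (constC β γ lam) f g (WithLp.toLp 2 ![xbar, xbar, 0]) = e)
    (hKL : KLAt (regularization lam (constC β γ lam) f g) (WithLp.toLp 2 ![xbar, xbar, 0])) :
    ∃ t₀, 0 ≤ t₀ ∧ ∃ I, ∀ t, t₀ ≤ t → ∫ r in t₀..t, ‖vel x r‖ + ‖acc x r‖ ≤ I := by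
  set en := energy β γ lam f g x with hen
  have hdec : ∀ s t, 0 ≤ s → s ≤ t →
      c * ∫ r in s..t, (‖vel x r‖ ^ 2 + ‖acc x r‖ ^ 2) ≤ en s - en t := fun s t hs hst => by
    have := hx.energy_sub_le hb hg hβ hgβ hγ hlam hA hB hs hst
    linarith
  -- If the energy ever reaches its limit it is constant afterwards and the motion stops; the delay
  -- `t₁ + 1` is there because `speed_le` looks back one unit of time.
  by_cases hcase : ∃ t₁, 0 ≤ t₁ ∧ en t₁ ≤ e
  · obtain ⟨t₁, ht₁, hen₁⟩ := hcase
    refine ⟨t₁ + 1, by linarith, 0, fun t ht => le_of_eq ?_⟩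
    rw [intervalIntegral.integral_congr (g := fun _ => (0 : ℝ))]
    · simp
    intro r hr
    rw [uIcc_of_le ht] at hr
    have h1 := hx.speed_le hβ hγ hlam (t := r) (by linarith [hr.1])
    have h2 : 0 ≤ ∫ s in t₁..(r - 1), (‖vel x s‖ ^ 2 + ‖acc x s‖ ^ 2) :=
      intervalIntegral.integral_nonneg (by linarith [hr.1]) fun r _ => by positivity
    have h3 := hdec t₁ (r - 1) ht₁ (by linarith [hr.1])
    have h4 := hdec (r - 1) r (by linarith [hr.1]) (by linarith)
    have h5 := he r (by linarith [hr.1])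
    have h6 : ∫ s in (r - 1)..r, (‖vel x s‖ ^ 2 + ‖acc x s‖ ^ 2) ≤ 0 := by
      have := mul_nonneg hc.le h2
      exact nonpos_of_mul_nonpos_right (by linarith) hc
    have h7 : ‖vel x r‖ ^ 2 + ‖acc x r‖ ^ 2 ≤ 0 :=
      h1.trans (mul_nonpos_of_nonneg_of_nonpos (by positivity) h6)
    have h8 : ‖vel x r‖ = 0 := by nlinarith [sq_nonneg ‖vel x r‖, sq_nonneg ‖acc x r‖]
    have h9 : ‖acc x r‖ = 0 := by nlinarith [sq_nonneg ‖vel x r‖, sq_nonneg ‖acc x r‖]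
    simp [h8, h9]
  push Not at hcase
  obtain ⟨M, hM, hsubg⟩ := hx.exists_subgradient_bound hb hg hβ hgβ hγ hlam
  obtain ⟨η, hη, U, hU, φ, hφ, hKL⟩ := hKL
  set S : Set ℝ := {s : ℝ | 0 ≤ s ∧ (s : EReal) < η} with hS
  -- A finite radius is used because `η` may be `+∞`.
  obtain ⟨η', hη0, hη'⟩ := EReal.lt_iff_exists_real_btwn.1 hη
  have hη0' : 0 < η' := by exact_mod_cast hη0
  have hSmem : ∀ r, 0 ≤ r → r < η' → r ∈ S := fun r h0 h1 =>
    ⟨h0, lt_trans (by exact_mod_cast h1) hη'⟩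
  have hopen : IsOpen {s : ℝ | 0 < s ∧ (s : EReal) < η} :=
    isOpen_Ioi.inter (isOpen_Iio.preimage continuous_coe_real_ereal)
  have hdiff : ∀ r, 0 < r → r < η' → DifferentiableAt ℝ φ r := fun r h0 h1 =>
    (hφ.contDiffOn.differentiableOn one_ne_zero).differentiableAt
      (hopen.mem_nhds ⟨h0, (hSmem r h0.le h1).2⟩)
  -- a product neighbourhood of the limit point
  obtain ⟨ρ, hρ, hball⟩ : ∃ ρ > 0, ∀ p v a : E, ‖p - xbar‖ < ρ → ‖v‖ < ρ → ‖a‖ < ρ →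
      WithLp.toLp 2 ![a + γ • v + p, p + (weight β γ lam * γ) • v, v] ∈ U := by
    have hcont : Continuous fun z : E × E × E => (WithLp.toLp 2 ![z.2.2 + γ • z.2.1 + z.1,
        z.1 + (weight β γ lam * γ) • z.2.1, z.2.1] : PiLp 2 (fun _ : Fin 3 => E)) := by
      refine (PiLp.continuous_toLp 2 _).comp (continuous_pi fun i => ?_)
      fin_cases i <;> simp <;> fun_prop
    have h1 := hcont.tendsto (xbar, 0, 0)
    simp only [smul_zero, add_zero, zero_add] at h1
    obtain ⟨ρ, hρ, h2⟩ := Metric.eventually_nhds_iff.1 (h1.eventually hU)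
    refine ⟨ρ, hρ, fun p v a hp hv ha => h2 (y := (p, v, a)) ?_⟩
    rw [Prod.dist_eq, Prod.dist_eq]
    simp only [dist_eq_norm, sub_zero]
    exact max_lt hp (max_lt hv ha)
  -- The `M` comes from the subgradient bound, the `2` from `(‖v‖ + ‖a‖)² ≤ 2 (‖v‖² + ‖a‖²)`.
  set c' := c / (2 * M) with hc'
  have hc'0 : 0 < c' := by positivity
  have hdiff_lim : Tendsto (fun t => en t - e) atTop (𝓝 0) := by simpa using hlim.sub_const e
  have hφlim : Tendsto (fun t => φ (en t - e)) atTop (𝓝 0) := by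
    have h1 : Tendsto (fun t => en t - e) atTop (𝓝[S] 0) := by
      refine tendsto_nhdsWithin_iff.2 ⟨hdiff_lim, ?_⟩
      filter_upwards [eventually_ge_atTop 0, hdiff_lim.eventually_lt_const hη0'] with t ht h
      exact hSmem _ (sub_nonneg.2 (he t ht)) h
    have h2 : Tendsto φ (𝓝[S] 0) (𝓝 (φ 0)) := hφ.continuousOn 0 (hSmem 0 le_rfl hη0')
    rw [hφ.zero] at h2
    exact h2.comp h1
  have hev := (eventually_ge_atTop (0 : ℝ)).and ((hdiff_lim.eventually_lt_const hη0').and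
    ((hφlim.eventually_lt_const (show 0 < c' * (ρ / 2) by positivity)).and
      (((tendsto_zero_iff_norm_tendsto_zero.1 hv0).eventually_lt_const hρ).and
        ((tendsto_zero_iff_norm_tendsto_zero.1 ha0).eventually_lt_const hρ))))
  obtain ⟨t₁, ht₁⟩ := eventually_atTop.1 hev
  have hxT' : ∀ᶠ k in atTop, ‖x (T k) - xbar‖ < ρ / 2 :=
    (tendsto_iff_norm_sub_tendsto_zero.1 hxT).eventually_lt_const (by positivity)
  obtain ⟨k, hk1, hk2⟩ := ((hT.eventually_ge_atTop t₁).and hxT').exists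
  set t₀ := T k
  have hev' := fun t (ht : t₀ ≤ t) => ht₁ t (hk1.trans ht)
  have ht₀ : 0 ≤ t₀ := (hev' t₀ le_rfl).1
  -- The right endpoint is excluded from the proximity condition, so the estimate still applies at
  -- the first exit time.
  have hlen : ∀ t, t₀ ≤ t → (∀ r ∈ Ico t₀ t, ‖x r - xbar‖ < ρ) →
      c' * ∫ r in t₀..t, (‖vel x r‖ + ‖acc x r‖) ≤ φ (en t₀ - e) := by
    intro t ht hr
    have hsub : Icc t₀ t ⊆ Ici 0 := fun r hr => ht₀.trans hr.1
    have hg' : Continuous (gradient g) :=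
      (LipschitzWith.of_dist_le_mul (K := ⟨β, hβ⟩) fun u w => by
        rw [dist_eq_norm, dist_eq_norm]; exact hgβ u w).continuous
    have hmem : ∀ r, t₀ ≤ r → en r - e ∈ S := fun r h =>
      hSmem _ (sub_nonneg.2 (he r (ht₀.trans h))) (hev' r h).2.1
    have h1 : φ (en t - e) - φ (en t₀ - e) ≤ ∫ r in t₀..t, -c' * (‖vel x r‖ + ‖acc x r‖) := by
      refine sub_le_integral_of_dini (F := fun t => φ (en t - e)) ht ?_ ?_ ?_
      · exact hφ.continuousOn.comp (((hx.continuousOn_energy hb hg hg').mono hsub).sub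
          continuousOn_const) fun r hr => hmem r hr.1
      · exact continuousOn_const.mul ((hx.continuousOn_vel.mono hsub).norm.add
          (hx.continuousOn_acc.mono hsub).norm)
      intro s hs ε hε
      have hs0 : 0 ≤ s := ht₀.trans hs.1
      have hes : 0 < en s - e := sub_pos.2 (hcase s hs0)
      have heη : en s - e < η' := (hev' s hs.1).2.1
      set D := deriv φ (en s - e) with hD
      have hDpos : 0 < D := hφ.deriv_pos _ hes (hSmem _ hes.le heη).2
      set n := ‖vel x s‖ + ‖acc x s‖ with hn
      have hn0 : 0 ≤ n := by positivity
      have hKLs : 1 ≤ D * (M * n) := by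
        obtain ⟨ξ, hξ, hξn⟩ := hsubg s hs0
        have hreg := hx.regularization_lifted hb hs0
        have h2 := hKL (lifted β γ lam x s)
          (hball _ _ _ (hr s hs) (hev' s hs.1).2.2.2.1 (hev' s hs.1).2.2.2.2)
        rw [hreg, hbar] at h2
        have h3 := h2 (by exact_mod_cast hcase s hs0) (by
          refine lt_of_lt_of_le ?_ (add_le_add_right hη'.le (e : EReal))
          rw [← EReal.coe_add, EReal.coe_lt_coe_iff]
          linarith)
        rw [EReal.toReal_coe, EReal.toReal_coe] at h3
        have h4 : (1 : ENNReal) ≤ ENNReal.ofReal (D * ‖ξ‖) := by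
          rw [ENNReal.ofReal_mul hDpos.le]
          refine h3.trans (mul_le_mul_right (Metric.infEDist_le_edist_of_mem hξ |>.trans ?_) _)
          rw [edist_dist, dist_zero_left]
        rw [ENNReal.one_le_ofReal] at h4
        exact h4.trans (mul_le_mul_of_nonneg_left hξn hDpos.le)
      have hkey : -c * D * (‖vel x s‖ ^ 2 + ‖acc x s‖ ^ 2) ≤ -c' * n := by
        have h2 : n ^ 2 ≤ 2 * (‖vel x s‖ ^ 2 + ‖acc x s‖ ^ 2) := add_sq_le
        have h3 : c' * n * 1 ≤ c' * n * (D * (M * n)) :=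
          mul_le_mul_of_nonneg_left hKLs (by positivity)
        have h4 : c' * n * (D * (M * n)) = c * D * n ^ 2 / 2 := by
          rw [hc']; field_simp
        have h5 := mul_le_mul_of_nonneg_left h2 (show 0 ≤ c * D by positivity)
        linarith
      filter_upwards [hx.energy_dini_neg hb hg hβ hgβ hγ hlam hA hB hs0
        (show 0 < ε / D by positivity), self_mem_nhdsWithin] with r hr hsr
      have h2 := concave_sub_le hφ.concave (hmem s hs.1) (hmem r (hs.1.trans (le_of_lt hsr)))
        (hdiff _ hes heη)
      rw [← hD, sub_sub_sub_cancel_right] at h2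
      have h3 := mul_le_mul_of_nonneg_left hr hDpos.le
      have h4 := mul_le_mul_of_nonneg_right hkey (sub_nonneg.2 (le_of_lt hsr))
      have h5 : D * ((-c * (‖vel x s‖ ^ 2 + ‖acc x s‖ ^ 2) + ε / D) * (r - s)) =
          -c * D * (‖vel x s‖ ^ 2 + ‖acc x s‖ ^ 2) * (r - s) + ε * (r - s) := by
        field_simp
      linarith
    rw [intervalIntegral.integral_const_mul] at h1
    have h2 := hφ.nonneg _ (hmem t ht).1 (hmem t ht).2
    linarith
  -- the trajectory stays near the limit point
  have htrap : ∀ t, t₀ ≤ t → ‖x t - xbar‖ < ρ := by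
    by_contra! hbad
    obtain ⟨t₂, ht₂, hbad⟩ := hbad
    -- First exit time from the ball: up to it the length is below `ρ / 2`, and the start is within
    -- `ρ / 2` of `xbar`, so it cannot exist.
    set B := Ici t₀ ∩ {t | ρ ≤ ‖x t - xbar‖} with hBdef
    have hBclosed : IsClosed B := by
      have : ContinuousOn (fun t => ‖x t - xbar‖) (Ici t₀) :=
        ((hx.continuousOn.mono (Ici_subset_Ici.2 ht₀)).sub continuousOn_const).norm
      exact this.preimage_isClosed_of_isClosed isClosed_Ici isClosed_Ici
    have hBbdd : BddBelow B := ⟨t₀, fun r hr => hr.1⟩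
    have hmin : sInf B ∈ B := hBclosed.csInf_mem ⟨t₂, ht₂, hbad⟩ hBbdd
    set τ := sInf B
    have hτ : t₀ ≤ τ := hmin.1
    have hbefore : ∀ r ∈ Ico t₀ τ, ‖x r - xbar‖ < ρ := fun r hr => by
      by_contra! h
      exact absurd (csInf_le hBbdd ⟨hr.1, h⟩) (not_le.2 hr.2)
    have h1 := hlen τ hτ hbefore
    have hsub : Icc t₀ τ ⊆ Ici 0 := fun r hr => ht₀.trans hr.1
    have hvc := hx.continuousOn_vel.mono hsub
    have hac := hx.continuousOn_acc.mono hsub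
    have h2 : x τ - x t₀ = ∫ r in t₀..τ, vel x r := by
      rw [intervalIntegral.integral_eq_sub_of_hasDeriv_right_of_le hτ
        (hx.continuousOn.mono hsub) (fun r hr => ?_) (hvc.intervalIntegrable_of_Icc hτ)]
      exact (hx.hasDerivWithinAt r (ht₀.trans hr.1.le)).mono
        fun s hs => (ht₀.trans hr.1.le).trans (le_of_lt hs)
    have h3 : ‖x τ - x t₀‖ ≤ ∫ r in t₀..τ, (‖vel x r‖ + ‖acc x r‖) := by
      rw [h2]
      refine (intervalIntegral.norm_integral_le_integral_norm hτ).trans ?_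
      exact intervalIntegral.integral_mono_on hτ (hvc.norm.intervalIntegrable_of_Icc hτ)
        ((hvc.norm.add hac.norm).intervalIntegrable_of_Icc hτ)
        fun r _ => le_add_of_nonneg_right (norm_nonneg _)
    have h4 := (hev' t₀ le_rfl).2.2.1
    have h5 : ∫ r in t₀..τ, (‖vel x r‖ + ‖acc x r‖) < ρ / 2 :=
      lt_of_mul_lt_mul_left (h1.trans_lt h4) hc'0.le
    have h6 : ‖x τ - xbar‖ ≤ ‖x τ - x t₀‖ + ‖x t₀ - xbar‖ := norm_sub_le_norm_sub_add_norm_sub _ _ _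
    have h7 : ρ ≤ ‖x τ - xbar‖ := hmin.2
    linarith
  refine ⟨t₀, ht₀, φ (en t₀ - e) / c', fun t ht => ?_⟩
  rw [le_div_iff₀ hc'0, mul_comm]
  exact hlen t ht fun r hr => htrap r hr.1

end IsProxFlow
end Regularization

/-! ### From the differential equation to convergence -/

section Trajectory

variable {E : Type*} [NormedAddCommGroup E] [InnerProductSpace ℝ E]
variable {β γ lam : ℝ} {f : E → EReal} {g : E → ℝ} {x : ℝ → E}

theorem abs_sub_le_of_lipschitz_gradient [CompleteSpace E] (hg : Differentiable ℝ g) (hβ : 0 ≤ β)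
    (hgβ : ∀ x y, ‖gradient g x - gradient g y‖ ≤ β * ‖x - y‖) (y z : E) :
    |g y - g z| ≤ ‖gradient g z‖ * ‖y - z‖ + β * ‖y - z‖ ^ 2 := by
  have h := Convex.norm_image_sub_le_of_norm_fderiv_le (𝕜 := ℝ) (f := g)
    (C := ‖gradient g z‖ + β * ‖y - z‖) (s := Metric.closedBall z ‖y - z‖) (x := z) (y := y)
    (fun u _ => hg u) (fun u hu => ?_) (convex_closedBall _ _)
    (Metric.mem_closedBall_self (norm_nonneg _)) (by rw [Metric.mem_closedBall, dist_eq_norm])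
  · rw [Real.norm_eq_abs] at h
    linarith
  · have e : ‖fderiv ℝ g u‖ = ‖gradient g u‖ := by
      rw [gradient, LinearIsometryEquiv.norm_map]
    rw [Metric.mem_closedBall, dist_eq_norm] at hu
    rw [e]
    calc ‖gradient g u‖ = ‖gradient g z + (gradient g u - gradient g z)‖ := by congr 1; abel
      _ ≤ ‖gradient g z‖ + β * ‖u - z‖ := (norm_add_le _ _).trans (by gcongr; exact hgβ _ _)
      _ ≤ _ := by gcongr

/-- By `L² ≥ (γ + 1)²`, the bracket in `A` is at least `2 γ`, so `A < 0` forces `β γ < γ / (2 lam)`.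
-/
theorem lipschitz_lt_of_constA_neg (hβ : 0 ≤ β) (hγ : 0 < γ) (hlam : 0 < lam)
    (hA : constA β γ lam < 0) : β < 1 / (2 * lam) := by
  have h1 := add_one_sq_le_L_sq hβ hγ hlam
  rw [constA] at hA
  have h2 : 1 / (2 * lam) = 1 / 2 * (1 / lam) := by ring
  have h3 : γ / lam = γ * (1 / lam) := by ring
  rw [h3] at hA
  rw [h2]
  have h4 := mul_le_mul_of_nonneg_left h1 hβ
  have h5 : 0 ≤ β * (3 * γ ^ 2 + 2) := by positivity
  have h6 : 0 < γ * (1 / lam - 2 * β) := by nlinarith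
  have h7 := pos_of_mul_pos_right h6 hγ.le
  linarith

/-- As `prox` is defined by choice, a minimizer must be shown to exist. The lower bound `f ≥ m - g`
and the quadratic growth of `g` give the required minorant, of curvature `β < 1 / (2 lam)`. -/
theorem isProxPoint_prox [ProperSpace E] (hf : IsProperConvexLSC f)
    (hg : Differentiable ℝ g) (hβ : 0 ≤ β)
    (hgβ : ∀ x y, ‖gradient g x - gradient g y‖ ≤ β * ‖x - y‖) (hβlam : β < 1 / (2 * lam))
    {m : ℝ} (hm : ∀ u, (m : EReal) ≤ addFun f g u) (z : E) : IsProxPoint lam f z (prox lam f z) := by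
  refine Classical.epsilon_spec (p := IsProxPoint lam f z) (exists_isProxPoint hf
    (m := m - g z) (K := ‖gradient g z‖) hβlam fun y => ?_)
  have h1 := hm y
  have h2 := (le_abs_self _).trans (abs_sub_le_of_lipschitz_gradient hg hβ hgβ y z)
  rw [addFun] at h1
  by_cases hy : f y = ⊤
  · rw [hy]; exact le_top
  lift f y to ℝ using ⟨hy, hf.ne_bot y⟩ with fy
  norm_cast at h1
  rw [EReal.coe_le_coe_iff]
  linarith

theorem IsTrajectory.isProxFlow [CompleteSpace E] (hf : IsProperConvexLSC f)
    (hgβ : ∀ x y, ‖gradient g x - gradient g y‖ ≤ β * ‖x - y‖) (hlam : 0 < lam)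
    (hprox : ∀ z, IsProxPoint lam f z (prox lam f z)) {u₀ v₀ : E}
    (hx : IsTrajectory γ lam f g u₀ v₀ x) : IsProxFlow β γ lam f g x := by
  have h1 := (contDiffOn_succ_iff_derivWithin (n := 1) (uniqueDiffOn_Ici (0 : ℝ))).1
    (by simpa [one_add_one_eq_two] using hx.contDiffOn)
  have h2 : ContDiffOn ℝ 1 (vel x) (Ici 0) := h1.2.2
  have hode : ∀ t, 0 ≤ t → proxCurve γ x t = prox lam f (x t - lam • gradient g (x t)) := hx.ode
  refine ⟨fun t ht => (h1.1 t ht).hasDerivWithinAt,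
    fun t ht => (h2.differentiableOn one_ne_zero t ht).hasDerivWithinAt,
    h2.continuousOn_derivWithin (uniqueDiffOn_Ici 0) le_rfl, fun t ht => ?_, fun s t hs ht => ?_⟩
  · have h3 := (hprox (x t - lam • gradient g (x t))).isSubgradient hf hlam
    rw [← hode t ht] at h3
    convert h3 using 1
    have : gradient g (x t) = (1 / lam) • lam • gradient g (x t) := by
      rw [smul_smul, one_div_mul_cancel hlam.ne', one_smul]
    rw [subgradCurve, this, proxCurve, smul_smul lam, mul_one_div_cancel hlam.ne', one_smul]
    module
  · have h3 := (hprox (x s - lam • gradient g (x s))).norm_sub_le hf hlam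
      (hprox (x t - lam • gradient g (x t)))
    rw [hode s hs, hode t ht]
    refine h3.trans ?_
    have e : x s - lam • gradient g (x s) - (x t - lam • gradient g (x t)) =
      (x s - x t) - lam • (gradient g (x s) - gradient g (x t)) := by module
    rw [e]
    refine (norm_sub_le _ _).trans ?_
    rw [norm_smul, Real.norm_of_nonneg hlam.le]
    have := mul_le_mul_of_nonneg_left (hgβ (x s) (x t)) hlam.le
    linarith

theorem integrableOn_Ici_of_bound {F : Type*} [NormedAddCommGroup F] {u : ℝ → F} (hu : ContinuousOn u (Ici 0))
    {t₀ I : ℝ} (ht₀ : 0 ≤ t₀) (hI : ∀ t, t₀ ≤ t → ∫ r in t₀..t, ‖u r‖ ≤ I) :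
    IntegrableOn u (Ici 0) := by
  have h1 : IntegrableOn u (Ioi t₀) := by
    refine integrableOn_Ioi_of_intervalIntegral_norm_bounded (b := id) (l := atTop) I t₀
      (fun t => ?_) tendsto_id ?_
    · exact ((hu.mono fun r hr => ht₀.trans hr.1).integrableOn_Icc (b := t)).mono_set
        Ioc_subset_Icc_self
    · filter_upwards [eventually_ge_atTop t₀] with t ht
      exact hI t ht
  have h2 : IntegrableOn u (Icc 0 t₀) := (hu.mono fun r hr => hr.1).integrableOn_Icc
  rw [← Icc_union_Ioi_eq_Ici ht₀]
  exact h2.union h1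

namespace IsProxFlow

/-- Limit points of the trajectory are critical, and the objective converges along it. -/
theorem limit_point [CompleteSpace E] (hx : IsProxFlow β γ lam f g x) (hb : ∀ u, f u ≠ ⊥)
    (hl : LowerSemicontinuous f) (hg : Differentiable ℝ g) (hg' : Continuous (gradient g))
    {e : ℝ} (hlim : Tendsto (energy β γ lam f g x) atTop (𝓝 e))
    (hv0 : Tendsto (vel x) atTop (𝓝 0)) (ha0 : Tendsto (acc x) atTop (𝓝 0))
    {xbar : E} {T : ℕ → ℝ} (hT0 : ∀ k, 0 ≤ T k) (hT : Tendsto T atTop atTop)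
    (hxT : Tendsto (fun k => x (T k)) atTop (𝓝 xbar)) :
    f xbar = ((e - g xbar : ℝ) : EReal) ∧ IsSubgradient f xbar (-gradient g xbar) := by
  have hv := hv0.comp hT
  have ha := ha0.comp hT
  have hy : Tendsto (fun k => proxCurve γ x (T k)) atTop (𝓝 xbar) := by
    simpa [proxCurve] using (ha.add (hv.const_smul γ)).add hxT
  have hw : Tendsto (fun k => subgradCurve γ lam g x (T k)) atTop (𝓝 (-gradient g xbar)) := by
    simpa [subgradCurve] using ((ha.add (hv.const_smul γ)).const_smul (-(1 / lam))).sub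
      ((hg'.tendsto xbar).comp hxT)
  -- The values of `f` converge because the energy does and its quadratic terms vanish; continuity
  -- of `f` is not available.
  have hF : Tendsto (fun k => (f (proxCurve γ x (T k))).toReal) atTop (𝓝 (e - g xbar)) := by
    have h1 := ((hlim.comp hT).sub ((hg.continuous.tendsto xbar).comp hy)).sub
      (((ha.add (hv.const_smul ((1 - weight β γ lam) * γ))).norm.pow 2).const_mul (1 / (2 * lam)))
    have h2 := h1.add ((hv.norm.pow 2).const_mul (constC β γ lam / (2 * lam)))
    simp only [smul_zero, add_zero, norm_zero, ne_eq, OfNat.ofNat_ne_zero, not_false_eq_true,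
      zero_pow, mul_zero, sub_zero] at h2
    refine h2.congr fun k => ?_
    simp only [Function.comp_apply, energy]
    ring
  exact IsSubgradient.of_tendsto hb hl (fun k => hx.isSubgradient _ (hT0 k))
    (fun k => (EReal.coe_toReal (hx.isSubgradient _ (hT0 k)).1 (hb _)).symm) hy hw hF

theorem integrable_and_tendsto [ProperSpace E] (hx : IsProxFlow β γ lam f g x) (hb : ∀ u, f u ≠ ⊥)
    (hl : LowerSemicontinuous f) (hg : Differentiable ℝ g) (hβ : 0 ≤ β)
    (hgβ : ∀ x y, ‖gradient g x - gradient g y‖ ≤ β * ‖x - y‖) (hγ : 0 < γ) (hlam : 0 < lam)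
    (hρ : CondRho β γ lam) {m : ℝ} (hm : ∀ u, (m : EReal) ≤ addFun f g u)
    {R : ℝ} (hR : ∀ t, 0 ≤ t → ‖x t‖ ≤ R)
    (hH : IsKL (regularization lam (constC β γ lam) f g)) :
    IntegrableOn (vel x) (Ici 0) ∧ IntegrableOn (acc x) (Ici 0) ∧
      ∃ xbar ∈ crit (addFun f g), Tendsto x atTop (𝓝 xbar) := by
  obtain ⟨hA, hB, hC⟩ := hρ
  have hg' : Continuous (gradient g) := (LipschitzWith.of_dist_le_mul (K := ⟨β, hβ⟩) fun u w => by
    rw [dist_eq_norm, dist_eq_norm]; exact hgβ u w).continuous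
  set c := min (-constA β γ lam) (-constB β γ lam) with hc_def
  have hc : 0 < c := lt_min (neg_pos.2 hA) (neg_pos.2 hB)
  have hAc : constA β γ lam ≤ -c := le_neg.1 (min_le_left _ _)
  have hBc : constB β γ lam ≤ -c := le_neg.1 (min_le_right _ _)
  obtain ⟨e, he, hlim, hv0, ha0⟩ :=
    hx.exists_tendsto_energy hb hg hβ hgβ hγ hlam hc hAc hBc hC.le hm
  obtain ⟨xbar, -, ψ, hψ, hxψ⟩ := tendsto_subseq_of_bounded (Metric.isBounded_closedBall (x := 0)
    (r := R)) (x := fun k : ℕ => x k) fun k => mem_closedBall_zero_iff.2 (hR k k.cast_nonneg)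
  have hT : Tendsto (fun k => (ψ k : ℝ)) atTop atTop :=
    tendsto_natCast_atTop_atTop.comp hψ.tendsto_atTop
  obtain ⟨hfx, hsx⟩ := hx.limit_point hb hl hg hg' hlim hv0 ha0 (fun k => (ψ k).cast_nonneg) hT hxψ
  have hcrit : xbar ∈ crit (addFun f g) := by
    simpa [crit] using hsx.mem_limitingSubdiff_addFun hb hg
  have hbar : regularization lam (constC β γ lam) f g (WithLp.toLp 2 ![xbar, xbar, 0]) = e := by
    simp only [regularization, addFun, Matrix.cons_val, hfx]
    norm_cast
    simp
  -- Criticality of `xbar` supplies the subgradient of `H` at `(xbar, xbar, 0)` that the KL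
  -- hypothesis asks for.
  have hKL := hH _ ⟨_, hsx.mem_limitingSubdiff_regularization hb hg lam (constC β γ lam) xbar 0⟩
  obtain ⟨t₀, ht₀, I, hI⟩ := hx.exists_length_bound hb hg hβ hgβ hγ hlam hc hAc hBc he hlim hv0 ha0
    hT hxψ hbar hKL
  have hsub : ∀ t, Icc t₀ t ⊆ Ici 0 := fun t r hr => ht₀.trans hr.1
  have hsum : ∀ t, t₀ ≤ t → IntervalIntegrable (fun r => ‖vel x r‖ + ‖acc x r‖) volume t₀ t :=
    fun t ht => ((hx.continuousOn_vel.mono (hsub t)).norm.add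
      (hx.continuousOn_acc.mono (hsub t)).norm).intervalIntegrable_of_Icc ht
  have hvint : IntegrableOn (vel x) (Ici 0) :=
    integrableOn_Ici_of_bound hx.continuousOn_vel ht₀ fun t ht => (intervalIntegral.integral_mono_on
      ht ((hx.continuousOn_vel.mono (hsub t)).norm.intervalIntegrable_of_Icc ht) (hsum t ht)
      fun r _ => le_add_of_nonneg_right (norm_nonneg _)).trans (hI t ht)
  have haint : IntegrableOn (acc x) (Ici 0) :=
    integrableOn_Ici_of_bound hx.continuousOn_acc ht₀ fun t ht => (intervalIntegral.integral_mono_on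
      ht ((hx.continuousOn_acc.mono (hsub t)).norm.intervalIntegrable_of_Icc ht) (hsum t ht)
      fun r _ => le_add_of_nonneg_left (norm_nonneg _)).trans (hI t ht)
  -- An integrable velocity makes `x` converge; the subsequence identifies the limit as `xbar`.
  have hconv := tendsto_limUnder_of_hasDerivAt_of_integrableOn_Ioi (f := x) (f' := vel x) (a := 0)
    (fun t ht => (hx.hasDerivWithinAt t (le_of_lt ht)).hasDerivAt (Ici_mem_nhds ht))
    (hvint.mono_set Ioi_subset_Ici_self)
  have heq := tendsto_nhds_unique (hconv.comp hT) hxψ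
  rw [heq] at hconv
  exact ⟨hvint, haint, xbar, hcrit, hconv⟩

end IsProxFlow
end Trajectory
end ProxGrad
end

theorem theorem4 (n : ℕ)
    (f : EuclideanSpace ℝ (Fin n) → EReal) (hf : ProxGrad.IsProperConvexLSC f)
    (g : EuclideanSpace ℝ (Fin n) → ℝ) (hg : Differentiable ℝ g)
    (β : ℝ) (hβ : 0 ≤ β)
    (hgβ : ∀ x y, ‖gradient g x - gradient g y‖ ≤ β * ‖x - y‖)
    (hbdd : ∃ m : ℝ, ∀ u, (m : EReal) ≤ ProxGrad.addFun f g u)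
    (γ lam : ℝ) (hγ : 0 < γ) (hlam : 0 < lam)
    (hρ : ProxGrad.CondRho β γ lam)
    (u₀ v₀ : EuclideanSpace ℝ (Fin n)) (x : ℝ → EuclideanSpace ℝ (Fin n))
    (hx : ProxGrad.IsTrajectory γ lam f g u₀ v₀ x)
    (hxbdd : ∃ M : ℝ, ∀ t, 0 ≤ t → ‖x t‖ ≤ M)
    (hH : ProxGrad.IsKL (ProxGrad.regularization lam (ProxGrad.constC β γ lam) f g)) :
    IntegrableOn (ProxGrad.vel x) (Ici 0) ∧
    IntegrableOn (ProxGrad.acc x) (Ici 0) ∧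
    ∃ xbar ∈ ProxGrad.crit (ProxGrad.addFun f g), Tendsto x atTop (𝓝 xbar) := by
  obtain ⟨m, hm⟩ := hbdd
  obtain ⟨R, hR⟩ := hxbdd
  have hβlam := ProxGrad.lipschitz_lt_of_constA_neg hβ hγ hlam hρ.1
  have hflow := hx.isProxFlow (β := β) hf hgβ hlam
    (ProxGrad.isProxPoint_prox hf hg hβ hgβ hβlam hm)
  exact hflow.integrable_and_tendsto hf.ne_bot hf.lsc hg hβ hgβ hγ hlam hρ hm hR hH
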